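/- Let $K$ be a local field of characteristic $p>0$ (non-discrete, locally compact, non-archimedean), with ring of integers $\mathfrak D=\{|x|\le 1\}$, maximal ideal $\mathfrak B=\{|x|<1\}$, residue field $\mathfrak D/\mathfrak B$ of cardinality $q=p^c$, prime element $\mathfrak p$ (an element of maximal absolute value in $\mathfrak B$), absolute value normalized by $|\mathfrak p|=q^{-1}$, and Haar measure $d\xi$ on $K^+$ normalized by $\int_{\mathfrak D}d\xi=1$. Let $\chi$ be a continuous unitary character of $K^+$ that is trivial on $\mathfrak D$ and non-trivial on $\mathfrak p^{-1}\mathfrak D$; put $\chi_y(x)=\chi(yx)$, and let $\hat f$ be the Fourier transform on $L^2(K)$, i.e. the $L^2$-continuous extension of $\hat f(\xi)=\int_K f(x)\chi(-\xi x)\,dx$ from $L^1(K)\cap L^2(K)$. Let $1=\epsilon_0,\dots,\epsilon_{c-1}\in\mathfrak D$ have residue classes that form a basis of $\mathfrak D/\mathfrak B$ over $\mathbb F_p$. Put $u(n)=\big(\sum_{k=0}^{c-1}a_k\epsilon_k\big)\mathfrak p^{-1}$ for $0\le n=\sum_{k=0}^{c-1} a_kp^k<q$ ($0\le a_k<p$),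 and $u(n)=\sum_{k=0}^s\mathfrak p^{-k}u(b_k)$ for $n=\sum_{k=0}^s b_kq^k\ge q$ ($0\le b_k<q$). Let $\Psi=\{\psi^{(1)},\dots,\psi^{(L)}\}\subset L^2(K)$ with $\widehat{\psi^{(m)}}=\mathbf 1_{W_m}$ a.e., where $W_1,\dots,W_L\subset K$ and $\bigcup_{m=1}^LW_m$ is measurable. Put $\psi^{(m)}_{j,t}(x)=q^{j/2}\psi^{(m)}(\mathfrak p^{-j}x-u(t))$ and suppose that the affine system $\mathcal W(\Psi)=\{\psi^{(m)}_{j,t}: 1\le m\le L,\ j\in\mathbb Z,\ t\in\mathbb N_0\}$ is a Bessel system with bound $1$, i.e. $\sum_{m=1}^L\sum_{j\in\mathbb Z}\sum_{t\in\mathbb N_0}|\langle g,\psi^{(m)}_{j,t}\rangle|^2\le\|g\|^2$ for all $g\in L^2(K)$. Then the following statements are equivalent. 1. For all $f\in L^2(K)$, $$\|f\|^2=\sum_{m=1}^L\sum_{j\in\mathbb Z}\sum_{t\in\mathbb N_0}q^{-j}\left|\int_{\mathfrak p^{-j}W_m}\hat f(\xi)\,\chi_{u(t)}(\mathfrak p^{j}\xi)\,d\xi\right|^2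 .$$ 2. $\{\mathfrak p^jW_m: j\in\mathbb Z,\ m=1,\dots,L\}$ is a measurable partition of $K$ a.e., i.e. the sets (indexed by $(j,m)$) are measurable, pairwise disjoint up to null sets, and cover $K$ up to a null set. 3. $\displaystyle\int_{\bigcup_{m=1}^LW_m}\frac{1}{|\xi|}\,d\xi=\frac{q-1}{q}$. -/

import Mathlib

open MeasureTheory Filter Topology
open scoped ENNReal NNReal Pointwise

noncomputable section

namespace LocalFieldWavelet

/-- The ring of integers `𝔇 = {x : |x| ≤ 1}` of a non-archimedean normed field. -/
abbrev ringOfIntegers (K : Type*) [NontriviallyNormedField K] [IsUltrametricDist K] :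
    ValuationSubring K :=
  (NormedField.valuation (K := K)).valuationSubring

/-- The cardinality `q` of the residue field `𝔇 / 𝔅`. -/
def residueCard (K : Type*) [NontriviallyNormedField K] [IsUltrametricDist K] : ℕ :=
  Nat.card (IsLocalRing.ResidueField (ringOfIntegers K))

section Field

variable {K : Type*} [NontriviallyNormedField K]

/-- `ϖ` is an element of maximal absolute value in `𝔅 = {x : |x| < 1}`. -/
def IsPrimeElement (ϖ : K) : Prop :=
  ‖ϖ‖ < 1 ∧ ∀ x : K, ‖x‖ < 1 → ‖x‖ ≤ ‖ϖ‖

/-- `ε₀ = 1, ε₁, …, ε_{c-1}` are integers of `K` whose residue classes form a basis of the residue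
field over its prime field `{0, …, p - 1}`: the combinations `∑ a_k ε_k` with `0 ≤ a_k < p`
represent every residue class exactly once. -/
def IsResidueBasis [IsUltrametricDist K] (p : ℕ) {c : ℕ} (ε : Fin c → ringOfIntegers K) : Prop :=
  (∀ k : Fin c, (k : ℕ) = 0 → ε k = 1) ∧
    Function.Bijective fun a : Fin c → Fin p =>
      IsLocalRing.residue (ringOfIntegers K) (∑ k, ((a k : ℕ) : ringOfIntegers K) * ε k)

/-- `u(b) = (∑ a_k ε_k) ϖ⁻¹` for `0 ≤ b < q`, where `b = ∑ a_k p ^ k` with `0 ≤ a_k < p`. -/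
def translationDigit (p : ℕ) {c : ℕ} (ε : Fin c → K) (ϖ : K) (b : ℕ) : K :=
  (∑ k : Fin c, ((b / p ^ (k : ℕ) % p : ℕ) : K) * ε k) * ϖ⁻¹

/-- `u(n) = ∑ ϖ ^ (-k) u(b_k)`, where `n = ∑ b_k q ^ k` with `0 ≤ b_k < q`
(the digits with index `k > n` vanish when `q ≥ 2`). -/
def translation [IsUltrametricDist K] (p : ℕ) {c : ℕ} (ε : Fin c → K) (ϖ : K) (n : ℕ) : K :=
  ∑ k ∈ Finset.range (n + 1), ϖ ^ (-(k : ℤ)) *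
    translationDigit p ε ϖ (n / residueCard K ^ k % residueCard K)

/-- The character `χ` of `K⁺` is continuous, trivial on `𝔇` and non-trivial on
`𝔅⁻¹ = ϖ⁻¹ 𝔇`. -/
def IsBasicCharacter (ϖ : K) (χ : AddChar K Circle) : Prop :=
  Continuous χ ∧ (∀ x : K, ‖x‖ ≤ 1 → χ x = 1) ∧ ∃ x : K, ‖ϖ * x‖ ≤ 1 ∧ χ x ≠ 1

end Field

section Fourier

variable {K : Type*} [NontriviallyNormedField K] [MeasurableSpace K]

/-- The integral `∫ f(x) χ(-ξ x) dx`. -/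
def fourierIntegral (χ : AddChar K Circle) (μ : Measure K) (f : K → ℂ) (ξ : K) : ℂ :=
  ∫ x, f x * (χ (-(ξ * x)) : ℂ) ∂μ

/-- `g ∈ L²` is the Fourier transform of `f ∈ L²`: the extension by `L²`-continuity of the
Fourier integral from `L¹ ∩ L²`. -/
def IsFourierTransform (χ : AddChar K Circle) (μ : Measure K) (f g : K → ℂ) : Prop :=
  MemLp f 2 μ ∧ MemLp g 2 μ ∧ ∃ F : ℕ → K → ℂ,
    (∀ n, MemLp (F n) 1 μ ∧ MemLp (F n) 2 μ) ∧
    Tendsto (fun n => eLpNorm (F n - f) 2 μ) atTop (𝓝 0) ∧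
    Tendsto (fun n => eLpNorm (fourierIntegral χ μ (F n) - g) 2 μ) atTop (𝓝 0)

open Classical in
/-- The Fourier transform on `L²(K)`, determined almost everywhere. By Plancherel's theorem the
default value `0` is never taken at a square integrable `f`. -/
def fourierL2 (χ : AddChar K Circle) (μ : Measure K) (f : K → ℂ) : K → ℂ :=
  if h : ∃ g, IsFourierTransform χ μ f g then h.choose else 0

end Fourier

section Affine

variable {K : Type*} [NontriviallyNormedField K] [IsUltrametricDist K]

/-- The function `x ↦ q ^ (j / 2) ψ(ϖ ^ (-j) x - u(t))`. -/
def affine (ϖ : K) (u : ℕ → K) (ψ : K → ℂ) (j : ℤ) (t : ℕ) (x : K) : ℂ :=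
  (((residueCard K : ℝ) ^ ((j : ℝ) / 2) : ℝ) : ℂ) * ψ (ϖ ^ (-j) * x - u t)

/-- The affine system generated by `ψ` is a Bessel system with bound `B`. -/
def IsBesselet [MeasurableSpace K] (μ : Measure K) (ϖ : K) (u : ℕ → K) {L : ℕ}
    (ψ : Fin L → K → ℂ) (B : ℝ≥0) : Prop :=
  ∀ g : K → ℂ, MemLp g 2 μ →
    ∑' (m : Fin L) (j : ℤ) (t : ℕ),
        ‖∫ x, g x * (starRingEnd ℂ) (affine ϖ u (ψ m) j t x) ∂μ‖ₑ ^ 2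
      ≤ (B : ℝ≥0∞) * eLpNorm g 2 μ ^ 2

end Affine

/-- The indexed family `A` is a measurable partition of the whole space up to null sets. -/
def IsPartitionAE {X ι : Type*} [MeasurableSpace X] (μ : Measure X) (A : ι → Set X) : Prop :=
  (∀ i, NullMeasurableSet (A i) μ) ∧ Pairwise (fun i k => AEDisjoint μ (A i) (A k)) ∧
    ∀ᵐ x ∂μ, x ∈ ⋃ i, A i

end LocalFieldWavelet

end

open LocalFieldWavelet

/-!
By Plancherel's theorem everything is a statement about Fourier transforms: the coefficient
`⟨f, ψ_{j,t}⟩` is, up to the factor `q ^ (-j / 2)`, the integral of `f̂ · χ(u(t) ϖ ^ j ·)` over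
`ϖ ^ (-j) W`, and the right-hand side of the first statement is the energy of these coefficients.

Plancherel's theorem and the analysis of the affine system both rest on the autocorrelation
`φ_h(z) = ∫ h(x + z) conj(h(x)) dx`, whose Fourier transform is `|ĥ|²`. It is continuous with
`φ_h(0) = ‖h‖²`, so its averages over small balls tend to `‖h‖²`. The average over
`{|z| ≤ q ^ (-T)}` equals `∫_{|ξ| ≤ q ^ T} |ĥ|²` by orthogonality of characters, which is Plancherel's theorem
(`lintegral_fourierIntegral_sq`).

Likewise `∑_{t < q ^ T} |∫ h χ(u(t) ·)|²` is the integral of `φ_h` against the kernel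
`D_T(z) = ∑_{t < q ^ T} χ(u(t) z)`. In characteristic `p` this kernel is a product of sums over
`p`-th roots of unity, hence nonnegative, and it equals `q ^ T` on the ball `{|z| ≤ q ^ (-T)}`. Thus
the sum is an average of `φ_h`, which tends to `‖h‖²`, plus an error term. The Bessel bound at `ψ`
says that for `h = 1_W` the sum is at most `‖h‖²`; so the nonnegative error term for `1_W` tends to
`0`, and it dominates the error terms of all bounded functions vanishing outside of `W`. Therefore
the characters `χ(u(t) ·)` satisfy Parseval's identity on `L²(W)` (`tsum_enorm_sq_eq_of_bounded`,
`tsum_enorm_sq_setIntegral_eq`). No periodization over a dual lattice is needed.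

Dilating, the coefficients of `f` of index `(j, m)` have energy `∫ |f̂|²` over `ϖ ^ (-j) W_m`. The
Bessel bound at `ψ^(n)` now reads `∑_{j,m} μ(W_n ∩ ϖ ^ (-j) W_m) ≤ μ(W_n)`, and the term `(0, n)`
already exhausts the right-hand side; hence the dilates are disjoint
(`pairwise_aedisjoint_dilates`), and the first statement says that `∫ |f̂|²` is carried by their
union `U` for all `f`. Testing on balls, this means that `U` is conull. Finally, `U` is invariant
under dilation, so it is conull as soon as it fills the annulus `{|ξ| = 1}`, of measure
`(q - 1) / q`, and folding `dξ / |ξ|` into this annulus gives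
`∫_{⋃ W_m} dξ / |ξ| = μ(U ∩ {|ξ| = 1})`
(`IsNormalized.lintegral_inv_norm_eq`).
-/

set_option linter.unusedSectionVars false

namespace LocalFieldWavelet

/-! ### Absolute values and Haar measure -/

section Haar

variable {K : Type*} [NontriviallyNormedField K]

lemma IsPrimeElement.ne_zero {ϖ : K} (hϖ : IsPrimeElement ϖ) : ϖ ≠ 0 := by
  rintro rfl
  obtain ⟨x, hx0, hx⟩ := NormedField.exists_norm_lt_one K
  have := hϖ.2 x hx
  simp only [norm_zero] at this
  linarith

/-- The value group of `K` is generated by `|ϖ|`. -/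
lemma IsPrimeElement.exists_norm_eq_zpow {ϖ : K} (hϖ : IsPrimeElement ϖ) {x : K} (hx : x ≠ 0) :
    ∃ j : ℤ, ‖x‖ = ‖ϖ‖ ^ j := by
  have h0 : 0 < ‖ϖ‖ := norm_pos_iff.2 hϖ.ne_zero
  obtain ⟨n, hn1, hn2⟩ := exists_mem_Ioc_zpow (norm_pos_iff.2 hx)
    ((one_lt_inv₀ h0).2 hϖ.1)
  simp only [inv_zpow', neg_add] at hn1 hn2
  refine ⟨-(n + 1), le_antisymm (by simpa [neg_add, add_comm] using hn2) ?_⟩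
  by_contra! h
  have h1 : ‖x * ϖ ^ (n + 1)‖ < 1 := by
    rw [norm_mul, norm_zpow]
    rw [zpow_neg, lt_inv_comm₀ (norm_pos_iff.2 hx) (by positivity)] at h
    calc ‖x‖ * ‖ϖ‖ ^ (n + 1) < ‖x‖ * ‖x‖⁻¹ :=
          mul_lt_mul_of_pos_left h (norm_pos_iff.2 hx)
      _ = 1 := mul_inv_cancel₀ (norm_pos_iff.2 hx).ne'
  have h2 := hϖ.2 _ h1
  rw [norm_mul, norm_zpow, zpow_add₀ h0.ne', zpow_one, ← mul_assoc] at h2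
  have h3 : ‖x‖ * ‖ϖ‖ ^ n ≤ 1 := le_of_mul_le_mul_right (by simpa using h2) h0
  rw [zpow_neg] at hn1
  have := mul_lt_mul_of_pos_right hn1 (zpow_pos h0 n)
  rw [inv_mul_cancel₀ (zpow_pos h0 n).ne'] at this
  linarith

lemma measurableSet_norm_le [MeasurableSpace K] [BorelSpace K] (r : ℝ) :
    MeasurableSet {x : K | ‖x‖ ≤ r} :=
  (isClosed_le continuous_norm continuous_const).measurableSet

lemma measurableSet_norm_lt [MeasurableSpace K] [BorelSpace K] (r : ℝ) :
    MeasurableSet {x : K | ‖x‖ < r} :=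
  (isOpen_lt continuous_norm continuous_const).measurableSet

variable [IsUltrametricDist K]

lemma one_lt_residueCard {ϖ : K} (hϖ : IsPrimeElement ϖ)
    (hnorm : ‖ϖ‖ = (residueCard K : ℝ)⁻¹) : 1 < residueCard K := by
  have h0 : 0 < ‖ϖ‖ := norm_pos_iff.2 hϖ.ne_zero
  have h1 := hϖ.1
  rw [hnorm] at h0 h1
  have h2 : (0 : ℝ) < residueCard K := inv_pos.1 h0
  exact_mod_cast (inv_lt_one₀ h2).1 h1

variable [MeasurableSpace K] [BorelSpace K]

/-- The ring of integers is the disjoint union of the `q` cosets of the maximal ideal. -/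
lemma residueCard_mul_measure_maximalIdeal [Finite (IsLocalRing.ResidueField (ringOfIntegers K))]
    (μ : Measure K) [μ.IsAddHaarMeasure] :
    (residueCard K : ℝ≥0∞) * μ {x : K | ‖x‖ < 1} = μ {x : K | ‖x‖ ≤ 1} := by
  classical
  let R := IsLocalRing.ResidueField (ringOfIntegers K)
  have : Fintype R := Fintype.ofFinite R
  have mem_iff : ∀ x : K, x ∈ ringOfIntegers K ↔ ‖x‖ ≤ 1 := fun x => by
    change (NormedField.valuation x ≤ 1) ↔ _
    rw [← NNReal.coe_le_coe]; rfl
  have res_iff : ∀ x : ringOfIntegers K,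
      IsLocalRing.residue (ringOfIntegers K) x = 0 ↔ ‖(x : K)‖ < 1 := fun x => by
    rw [IsLocalRing.residue_eq_zero_iff]
    exact Valuation.mem_maximalIdeal_iff K NormedField.valuation
  choose s hs using IsLocalRing.residue_surjective (R := ringOfIntegers K)
  have hU : {x : K | ‖x‖ ≤ 1} = ⋃ r : R, (fun x => -(s r : K) + x) ⁻¹' {x : K | ‖x‖ < 1} := by
    ext x
    simp only [Set.mem_ofPred_eq, Set.mem_iUnion, Set.mem_preimage]
    constructor
    · intro hx
      refine ⟨IsLocalRing.residue _ ⟨x, (mem_iff x).2 hx⟩, ?_⟩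
      have := (res_iff (⟨x, (mem_iff x).2 hx⟩ - s (IsLocalRing.residue _ ⟨x, (mem_iff x).2 hx⟩))).1
        (by rw [map_sub, hs, sub_self])
      simpa [sub_eq_neg_add] using this
    · rintro ⟨r, hr⟩
      have : x = s r + (-(s r : K) + x) := by ring
      rw [this]
      exact (IsUltrametricDist.norm_add_le_max _ _).trans
        (max_le ((mem_iff _).1 (s r).2) hr.le)
  rw [hU, measure_iUnion]
  · simp only [measure_preimage_add]
    rw [tsum_fintype, Finset.sum_const, nsmul_eq_mul, Finset.card_univ, residueCard,
      Nat.card_eq_fintype_card]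
  · intro r r' hrr'
    refine Set.disjoint_left.2 fun x hx hx' => hrr' ?_
    rw [← hs r, ← hs r', ← sub_eq_zero, ← map_sub, res_iff]
    have : ((s r - s r' : ringOfIntegers K) : K) = (-(s r' : K) + x) - (-(s r : K) + x) := by
      push_cast; ring
    rw [this]
    exact by
      simpa [sub_eq_add_neg] using
        (IsUltrametricDist.norm_add_le_max _ _).trans_lt (max_lt hx' ((norm_neg _).trans_lt hx))
  · exact fun r => (measurable_const_add _) (measurableSet_norm_lt 1)

/-- `ϖ` is a prime element of `K` with the normalized absolute value `|ϖ| = q⁻¹`, and the ring of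
integers has `μ`-measure `1`. -/
structure IsNormalized (ϖ : K) (μ : Measure K) : Prop where
  prime : IsPrimeElement ϖ
  norm_eq : ‖ϖ‖ = (residueCard K : ℝ)⁻¹
  measure_eq : μ {x : K | ‖x‖ ≤ 1} = 1

lemma secondCountable_of_locallyCompact (K : Type*) [NontriviallyNormedField K]
    [LocallyCompactSpace K] : SecondCountableTopology K :=
  have : ProperSpace K := ProperSpace.of_locallyCompactSpace K
  inferInstance

namespace IsNormalized

variable {ϖ : K} {μ : Measure K}

lemma one_lt_q (H : IsNormalized ϖ μ) : 1 < residueCard K := one_lt_residueCard H.prime H.norm_eq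

lemma q_pos (H : IsNormalized ϖ μ) : (0 : ℝ) < residueCard K := by
  exact_mod_cast zero_lt_one.trans H.one_lt_q

lemma q_ne_zero (H : IsNormalized ϖ μ) : (residueCard K : ℝ≥0∞) ≠ 0 := by
  exact_mod_cast (zero_lt_one.trans H.one_lt_q).ne'

lemma norm_zpow (H : IsNormalized ϖ μ) (j : ℤ) : ‖ϖ ^ j‖ = (residueCard K : ℝ) ^ (-j) := by
  rw [_root_.norm_zpow, H.norm_eq, inv_zpow']

lemma setOf_norm_le_eq_smul (H : IsNormalized ϖ μ) (j : ℤ) :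
    {x : K | ‖x‖ ≤ (residueCard K : ℝ) ^ j} = ϖ ^ (-j) • {x : K | ‖x‖ ≤ 1} := by
  ext x
  rw [Set.mem_smul_set_iff_inv_smul_mem₀ (zpow_ne_zero _ H.prime.ne_zero)]
  simp only [Set.mem_ofPred_eq, smul_eq_mul, norm_mul, norm_inv, H.norm_zpow, neg_neg]
  rw [inv_mul_le_iff₀ (zpow_pos H.q_pos j), mul_one]

variable [LocallyCompactSpace K] [μ.IsAddHaarMeasure]

/-- Multiplication by `ϖ` scales the Haar measure by `q⁻¹`, the measure of the maximal ideal. -/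
lemma measure_smul (H : IsNormalized ϖ μ) (j : ℤ) (s : Set K) :
    μ (ϖ ^ j • s) = (residueCard K : ℝ≥0∞) ^ (-j) * μ s := by
  have := secondCountable_of_locallyCompact K
  have hfin : Finite (IsLocalRing.ResidueField (ringOfIntegers K)) :=
    Nat.finite_of_card_ne_zero (zero_lt_one.trans H.one_lt_q).ne'
  have hq := H.q_ne_zero
  have hball : ϖ • {x : K | ‖x‖ ≤ 1} = {x : K | ‖x‖ < 1} := by
    ext x
    rw [Set.mem_smul_set_iff_inv_smul_mem₀ H.prime.ne_zero]
    simp only [Set.mem_ofPred_eq, smul_eq_mul, norm_mul, norm_inv]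
    rw [inv_mul_le_iff₀ (norm_pos_iff.2 H.prime.ne_zero), mul_one]
    exact ⟨fun h => h.trans_lt H.prime.1, H.prime.2 x⟩
  have h1 : distribHaarChar K (Units.mk0 ϖ H.prime.ne_zero) = (residueCard K : ℝ≥0)⁻¹ := by
    refine distribHaarChar_eq_of_measure_smul_eq_mul (μ := μ) (s := {x : K | ‖x‖ ≤ 1})
      (by simp [H.measure_eq]) (by simp [H.measure_eq]) ?_
    have h2 := residueCard_mul_measure_maximalIdeal μ
    rw [← hball] at h2
    rw [← h2, ENNReal.coe_inv (by exact_mod_cast hq), ENNReal.coe_natCast, ← mul_assoc,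
      ENNReal.inv_mul_cancel hq (by simp), one_mul]
    rfl
  have h2 := distribHaarChar_mul (A := K) μ (Units.mk0 ϖ H.prime.ne_zero ^ j) s
  rw [map_zpow, h1] at h2
  have h3 : Units.mk0 ϖ H.prime.ne_zero ^ j • s = ϖ ^ j • s := by
    change (fun x => _) '' s = (fun x => _) '' s
    simp
  rw [← h3, ← h2, inv_zpow', ENNReal.coe_zpow (by exact_mod_cast hq)]
  simp

lemma map_mul (H : IsNormalized ϖ μ) (j : ℤ) :
    μ.map (fun x => ϖ ^ j * x) = (residueCard K : ℝ≥0∞) ^ j • μ := by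
  have h0 : ϖ ^ j ≠ 0 := zpow_ne_zero _ H.prime.ne_zero
  ext s hs
  rw [Measure.map_apply (measurable_const_mul _) hs, Measure.smul_apply, smul_eq_mul]
  have := H.measure_smul (-j) s
  rw [neg_neg] at this
  rw [← this]
  congr 1
  ext x
  rw [Set.mem_smul_set_iff_inv_smul_mem₀ (zpow_ne_zero _ H.prime.ne_zero)]
  simp

lemma measurableEmbedding_mul (H : IsNormalized ϖ μ) (j : ℤ) :
    MeasurableEmbedding (fun x : K => ϖ ^ j * x) :=
  (Homeomorph.mulLeft₀ (ϖ ^ j) (zpow_ne_zero _ H.prime.ne_zero)).measurableEmbedding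

lemma quasiMeasurePreserving_mul (H : IsNormalized ϖ μ) (j : ℤ) :
    Measure.QuasiMeasurePreserving (fun x : K => ϖ ^ j * x) μ μ :=
  ⟨(H.measurableEmbedding_mul j).measurable, by
    rw [H.map_mul]; exact Measure.smul_absolutelyContinuous⟩

lemma lintegral_comp_mul (H : IsNormalized ϖ μ) (j : ℤ) (f : K → ℝ≥0∞) :
    ∫⁻ x, f (ϖ ^ j * x) ∂μ = (residueCard K : ℝ≥0∞) ^ j * ∫⁻ x, f x ∂μ := by
  rw [← (H.measurableEmbedding_mul j).lintegral_map, H.map_mul, lintegral_smul_measure,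
    smul_eq_mul]

lemma integral_comp_mul (H : IsNormalized ϖ μ) (j : ℤ) (f : K → ℂ) :
    ∫ x, f (ϖ ^ j * x) ∂μ = ((residueCard K : ℝ) ^ j : ℝ) * ∫ x, f x ∂μ := by
  rw [← (H.measurableEmbedding_mul j).integral_map, H.map_mul, integral_smul_measure,
    ← ENNReal.rpow_intCast, ← ENNReal.toReal_rpow, ENNReal.toReal_natCast, Real.rpow_intCast,
    Complex.real_smul]

lemma measure_norm_le (H : IsNormalized ϖ μ) (j : ℤ) :
    μ {x : K | ‖x‖ ≤ (residueCard K : ℝ) ^ j} = (residueCard K : ℝ≥0∞) ^ j := by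
  rw [H.setOf_norm_le_eq_smul, H.measure_smul, neg_neg, H.measure_eq, mul_one]

end IsNormalized

end Haar

/-! ### Autocorrelations -/

section Correlation

variable {K : Type*} [NontriviallyNormedField K] [MeasurableSpace K]

/-- The autocorrelation `z ↦ ∫ h(x + z) conj(h(x)) dx` of `h`. -/
noncomputable def correlation (μ : Measure K) (h : K → ℂ) (z : K) : ℂ :=
  ∫ x, h (x + z) * (starRingEnd ℂ) (h x) ∂μ

variable [BorelSpace K] [LocallyCompactSpace K] {μ : Measure K} [μ.IsAddHaarMeasure]

/-- This is the continuity of translations in `L²`. -/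
lemma continuous_correlation {h : K → ℂ} (hh : MemLp h 2 μ) : Continuous (correlation μ h) := by
  have := secondCountable_of_locallyCompact K
  have : Fact ((2 : ℝ≥0∞) ≠ ∞) := ⟨by simp⟩
  have key : correlation μ h =
      fun z => inner ℂ (hh.toLp h) (DomAddAct.mk z +ᵥ hh.toLp h) := by
    ext z
    rw [DomAddAct.mk_vadd_toLp, L2.inner_def]
    refine integral_congr_ae ?_
    filter_upwards [hh.coeFn_toLp, (hh.comp_measurePreserving
      (measurePreserving_vadd z μ)).coeFn_toLp] with x hx hx'
    refine Eq.trans ?_ (congrArg₂ (inner ℂ) hx hx').symm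
    rw [RCLike.inner_apply, Function.comp_apply, vadd_eq_add, add_comm z x]
  rw [key]
  have h2 : Continuous fun z : K => (DomAddAct.mk z : Kᵈᵃᵃ) := DomAddAct.continuous_mk
  exact continuous_const.inner (h2.vadd continuous_const)

lemma correlation_zero (μ : Measure K) (h : K → ℂ) :
    correlation μ h 0 = ((∫ x, ‖h x‖ ^ 2 ∂μ : ℝ) : ℂ) := by
  rw [correlation, ← integral_complex_ofReal]
  congr 1; ext x
  rw [add_zero, Complex.mul_conj']
  push_cast; rfl

lemma continuous_circle_coe {χ : AddChar K Circle} (hχ : Continuous χ) :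
    Continuous fun x => (χ x : ℂ) :=
  have h : Continuous fun z : Circle => (z : ℂ) := by fun_prop
  h.comp hχ

/-- Fubini's theorem after the shear `(x, z) ↦ (x, x + z)`. -/
lemma integrable_prod_correlation {h : K → ℂ} (hh : Integrable h μ) {χ : AddChar K Circle}
    (hχ : Continuous χ) :
    Integrable (fun P : K × K => h (P.1 + P.2) * (starRingEnd ℂ) (h P.1) * (χ P.2 : ℂ))
        (μ.prod μ) ∧
      ∫ P : K × K, h (P.1 + P.2) * (starRingEnd ℂ) (h P.1) * (χ P.2 : ℂ) ∂(μ.prod μ) =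
        (∫ x, h x * (χ x : ℂ) ∂μ) * (starRingEnd ℂ) (∫ x, h x * (χ x : ℂ) ∂μ) := by
  have := secondCountable_of_locallyCompact K
  have hmp := measurePreserving_prod_add μ μ
  have hcc := continuous_circle_coe hχ
  have hg : Integrable (fun x => h x * (χ x : ℂ)) μ :=
    hh.mul_bdd (c := 1) hcc.aestronglyMeasurable
      (.of_forall fun x => (Circle.norm_coe (χ x)).le)
  have hg' : Integrable (fun x => (starRingEnd ℂ) (h x * (χ x : ℂ))) μ := by
    refine ⟨Complex.continuous_conj.comp_aestronglyMeasurable hg.1, ?_⟩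
    simpa [HasFiniteIntegral, enorm_eq_nnnorm] using hg.2
  have hP : Integrable (fun P : K × K => (starRingEnd ℂ) (h P.1 * (χ P.1 : ℂ)) *
      (h P.2 * (χ P.2 : ℂ))) (μ.prod μ) := hg'.mul_prod hg
  have heq : (fun P : K × K => h (P.1 + P.2) * (starRingEnd ℂ) (h P.1) * (χ P.2 : ℂ)) =
      (fun P : K × K => (starRingEnd ℂ) (h P.1 * (χ P.1 : ℂ)) * (h P.2 * (χ P.2 : ℂ))) ∘
        fun z : K × K => (z.1, z.1 + z.2) := by
    ext P
    have h1 : (starRingEnd ℂ) (χ P.1 : ℂ) * (χ P.1 : ℂ) = 1 := by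
      rw [mul_comm, Complex.mul_conj', Circle.norm_coe]; simp
    simp only [Function.comp, AddChar.map_add_eq_mul, Circle.coe_mul, map_mul]
    linear_combination (-(h (P.1 + P.2) * (starRingEnd ℂ) (h P.1) * (χ P.2 : ℂ))) * h1
  constructor
  · rw [heq]; exact hmp.integrable_comp_of_integrable hP
  · have hemb : MeasurableEmbedding (fun z : K × K => (z.1, z.1 + z.2)) :=
      (MeasurableEquiv.shearAddRight K).measurableEmbedding
    rw [heq]
    simp only [Function.comp_def]
    rw [hmp.integral_comp hemb (fun P : K × K => (starRingEnd ℂ) (h P.1 * (χ P.1 : ℂ)) *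
      (h P.2 * (χ P.2 : ℂ))), integral_prod_mul (fun x => (starRingEnd ℂ) (h x * (χ x : ℂ)))
      (fun x => h x * (χ x : ℂ)), integral_conj, mul_comm]

lemma integrable_correlation {h : K → ℂ} (hh : Integrable h μ) :
    Integrable (correlation μ h) μ := by
  have := secondCountable_of_locallyCompact K
  have h1 :=
    (integrable_prod_correlation (μ := μ) hh (χ := 1) continuous_const).1.integral_prod_right
  simpa [correlation] using! h1

/-- The Fourier transform of the autocorrelation of `h` is the squared modulus of the Fourier
transform of `h`. -/
lemma integral_correlation_mul {h : K → ℂ} (hh : Integrable h μ) {χ : AddChar K Circle}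
    (hχ : Continuous χ) :
    ∫ z, correlation μ h z * (χ z : ℂ) ∂μ = ((‖∫ x, h x * (χ x : ℂ) ∂μ‖ ^ 2 : ℝ) : ℂ) := by
  have := secondCountable_of_locallyCompact K
  obtain ⟨h1, h2⟩ := integrable_prod_correlation (μ := μ) hh hχ
  rw [Complex.ofReal_pow, ← Complex.mul_conj', ← h2, integral_prod_symm _ h1]
  simp only [correlation, integral_mul_const]

variable [IsUltrametricDist K] {ϖ : K}

/-- The averages of a function over small balls around `0` converge to its value at a point of
continuity. -/
lemma IsNormalized.tendsto_average (H : IsNormalized ϖ μ) {φ : K → ℂ} (hφ : ContinuousAt φ 0)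
    (hi : Integrable φ μ) :
    Tendsto (fun T : ℕ => ((residueCard K : ℝ) ^ (T : ℤ) : ℝ) *
      ∫ z in {z : K | ‖z‖ ≤ (residueCard K : ℝ) ^ (-(T : ℤ))}, φ z ∂μ) atTop (𝓝 (φ 0)) := by
  rw [Metric.tendsto_atTop]
  intro e he
  obtain ⟨δ, hδ, hball⟩ := Metric.continuousAt_iff.1 hφ (e / 2) (by positivity)
  have hq := H.q_pos
  have hq1 : (residueCard K : ℝ)⁻¹ < 1 := inv_lt_one_of_one_lt₀ (by exact_mod_cast H.one_lt_q)
  obtain ⟨N, hN⟩ := exists_pow_lt_of_lt_one hδ hq1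
  refine ⟨N, fun T hT => ?_⟩
  set B := {z : K | ‖z‖ ≤ (residueCard K : ℝ) ^ (-(T : ℤ))} with hB
  have hμB : μ B = (residueCard K : ℝ≥0∞) ^ (-(T : ℤ)) := H.measure_norm_le _
  have hμB' : μ.real B = (residueCard K : ℝ) ^ (-(T : ℤ)) := by
    rw [Measure.real, hμB, ← ENNReal.rpow_intCast, ← ENNReal.toReal_rpow, ENNReal.toReal_natCast,
      Real.rpow_intCast]
  have hfin : μ B < ∞ := by
    rw [hμB]; exact ENNReal.zpow_lt_top H.q_ne_zero (by simp) _
  have hpow : 0 < (residueCard K : ℝ) ^ (T : ℤ) := zpow_pos hq _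
  have h1 : ‖∫ z in B, (φ z - φ 0) ∂μ‖ ≤ e / 2 * μ.real B := by
    refine norm_setIntegral_le_of_norm_le_const hfin fun z hz => ?_
    rw [← dist_eq_norm]
    refine (hball ?_).le
    rw [dist_zero_right]
    refine lt_of_le_of_lt hz (lt_of_le_of_lt ?_ hN)
    rw [zpow_neg, zpow_natCast, ← inv_pow]
    exact pow_le_pow_of_le_one (by positivity) hq1.le hT
  rw [integral_sub hi.integrableOn (integrable_const_iff.2 (Or.inr ⟨by simpa using hfin⟩)),
    setIntegral_const, hμB'] at h1
  have h2 : ((residueCard K : ℝ) ^ (T : ℤ) : ℝ) * ∫ z in B, φ z ∂μ - φ 0 =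
      ((residueCard K : ℝ) ^ (T : ℤ) : ℝ) *
        (∫ z in B, φ z ∂μ - (residueCard K : ℝ) ^ (-(T : ℤ)) • φ 0) := by
    rw [mul_sub, Complex.real_smul, ← mul_assoc, ← Complex.ofReal_mul, ← zpow_add₀ hq.ne']
    simp
  rw [dist_eq_norm, h2, norm_mul, Complex.norm_real, Real.norm_of_nonneg hpow.le]
  calc _ ≤ (residueCard K : ℝ) ^ (T : ℤ) * (e / 2 * (residueCard K : ℝ) ^ (-(T : ℤ))) := by gcongr
    _ = e / 2 := by rw [zpow_neg]; field_simp
    _ < e := by linarith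

/-- The average of `correlation μ h` over small balls tends to the squared norm of `h`. -/
lemma IsNormalized.tendsto_average_correlation (H : IsNormalized ϖ μ) {h : K → ℂ}
    (hh : Integrable h μ) (hh2 : MemLp h 2 μ) :
    Tendsto (fun T : ℕ => ((residueCard K : ℝ) ^ (T : ℤ) : ℝ) *
      ∫ z in {z : K | ‖z‖ ≤ (residueCard K : ℝ) ^ (-(T : ℤ))}, correlation μ h z ∂μ) atTop
      (𝓝 ((∫ x, ‖h x‖ ^ 2 ∂μ : ℝ) : ℂ)) := by
  rw [← correlation_zero]
  exact H.tendsto_average (continuous_correlation hh2).continuousAt (integrable_correlation hh)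

end Correlation

/-! ### Plancherel's theorem -/

section Plancherel

lemma eLpNorm_two_sq {X : Type*} [MeasurableSpace X] (μ : Measure X) (f : X → ℂ) :
    eLpNorm f 2 μ ^ 2 = ∫⁻ x, ‖f x‖ₑ ^ 2 ∂μ := by
  have := eLpNorm_nnreal_pow_eq_lintegral (μ := μ) (f := f) (p := 2) two_ne_zero
  simpa using this

lemma lintegral_enorm_sq_eq_ofReal {X : Type*} [MeasurableSpace X] {μ : Measure X} {f : X → ℂ}
    (hf : MemLp f 2 μ) :
    ∫⁻ x, ‖f x‖ₑ ^ 2 ∂μ = ENNReal.ofReal (∫ x, ‖f x‖ ^ 2 ∂μ) := by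
  rw [ofReal_integral_eq_lintegral_ofReal (hf.integrable_norm_pow two_ne_zero)
    (.of_forall fun x => by positivity)]
  congr 1; ext x
  rw [ENNReal.ofReal_pow (norm_nonneg _), ofReal_norm]

variable {K : Type*} [NontriviallyNormedField K] [IsUltrametricDist K] [MeasurableSpace K]
  [BorelSpace K] {ϖ : K} {μ : Measure K} {χ : AddChar K Circle}

lemma IsBasicCharacter.exists_ne_one (H : IsNormalized ϖ μ) (hχ : IsBasicCharacter ϖ χ) {z : K}
    {T : ℤ} (hz : ¬ ‖z‖ ≤ (residueCard K : ℝ) ^ (-T)) :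
    ∃ ξ : K, ‖ξ‖ ≤ (residueCard K : ℝ) ^ T ∧ χ (-(ξ * z)) ≠ 1 := by
  obtain ⟨x, hx, hx1⟩ := hχ.2.2
  have hq := H.q_pos
  have hz0 : z ≠ 0 := by
    rintro rfl
    exact hz (by rw [norm_zero]; positivity)
  refine ⟨-(x / z), ?_, by rwa [neg_mul, neg_neg, div_mul_cancel₀ _ hz0]⟩
  obtain ⟨j, hj⟩ := H.prime.exists_norm_eq_zpow hz0
  rw [norm_neg, norm_div, div_le_iff₀ (norm_pos_iff.2 hz0)]
  rw [hj, H.norm_eq, inv_zpow', not_le] at hz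
  have hlt : -T < -j := (zpow_lt_zpow_iff_right₀ (by exact_mod_cast H.one_lt_q)).1 hz
  rw [norm_mul, H.norm_eq, inv_mul_le_iff₀ hq, mul_one] at hx
  rw [hj, H.norm_eq, inv_zpow', ← zpow_add₀ hq.ne']
  refine hx.trans ?_
  calc (residueCard K : ℝ) = (residueCard K : ℝ) ^ (1 : ℤ) := (zpow_one _).symm
    _ ≤ _ := zpow_le_zpow_right₀ (by exact_mod_cast H.one_lt_q.le) (by omega)

variable [LocallyCompactSpace K] [μ.IsAddHaarMeasure]

lemma IsNormalized.measureReal_norm_le (H : IsNormalized ϖ μ) (T : ℤ) :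
    μ.real {x : K | ‖x‖ ≤ (residueCard K : ℝ) ^ T} = (residueCard K : ℝ) ^ T := by
  rw [Measure.real, H.measure_norm_le, ← ENNReal.rpow_intCast, ← ENNReal.toReal_rpow,
    ENNReal.toReal_natCast, Real.rpow_intCast]

lemma IsNormalized.measure_norm_le_lt_top (H : IsNormalized ϖ μ) (T : ℤ) :
    μ {x : K | ‖x‖ ≤ (residueCard K : ℝ) ^ T} < ∞ := by
  rw [H.measure_norm_le]; exact ENNReal.zpow_lt_top H.q_ne_zero (by simp) _

/-- Orthogonality of characters on balls. -/
lemma IsBasicCharacter.setIntegral_norm_le (H : IsNormalized ϖ μ) (hχ : IsBasicCharacter ϖ χ)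
    (T : ℤ) (z : K) :
    ∫ ξ in {ξ : K | ‖ξ‖ ≤ (residueCard K : ℝ) ^ T}, (χ (-(ξ * z)) : ℂ) ∂μ =
      {z : K | ‖z‖ ≤ (residueCard K : ℝ) ^ (-T)}.indicator
        (fun _ => (((residueCard K : ℝ) ^ T : ℝ) : ℂ)) z := by
  set B := {ξ : K | ‖ξ‖ ≤ (residueCard K : ℝ) ^ T} with hB
  have hBm : MeasurableSet B := measurableSet_norm_le _
  by_cases hz : ‖z‖ ≤ (residueCard K : ℝ) ^ (-T)
  · rw [Set.indicator_of_mem (by exact hz), setIntegral_congr_fun (g := fun _ => (1 : ℂ)) hBm]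
    · rw [setIntegral_const, H.measureReal_norm_le, Complex.real_smul, mul_one]
    · intro ξ hξ
      have : ‖-(ξ * z)‖ ≤ 1 := by
        rw [norm_neg, norm_mul]
        calc _ ≤ (residueCard K : ℝ) ^ T * (residueCard K : ℝ) ^ (-T) :=
              mul_le_mul hξ hz (norm_nonneg _) (zpow_pos H.q_pos _).le
          _ = 1 := by rw [← zpow_add₀ H.q_pos.ne', add_neg_cancel, zpow_zero]
      simp only [hχ.2.1 _ this, Circle.coe_one]
  · rw [Set.indicator_of_notMem (by exact hz)]
    obtain ⟨ξ₀, h0, h1⟩ := hχ.exists_ne_one H hz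
    rw [← integral_indicator hBm]
    set I := ∫ ξ, B.indicator (fun ξ => (χ (-(ξ * z)) : ℂ)) ξ ∂μ with hI
    -- translating by `ξ₀` multiplies the integral by a number different from `1`
    have h2 : I = (χ (-(ξ₀ * z)) : ℂ) * I := by
      conv_lhs => rw [hI, ← integral_add_left_eq_self _ ξ₀]
      rw [hI, ← integral_const_mul]
      congr 1; ext ξ
      have hmem : ξ₀ + ξ ∈ B ↔ ξ ∈ B := by
        constructor
        · intro h
          have : ξ = -ξ₀ + (ξ₀ + ξ) := by ring
          rw [this]
          exact (IsUltrametricDist.norm_add_le_max _ _).trans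
            (max_le ((norm_neg _).trans_le h0) h)
        · exact fun h => (IsUltrametricDist.norm_add_le_max _ _).trans (max_le h0 h)
      by_cases hξ : ξ ∈ B
      · rw [Set.indicator_of_mem hξ, Set.indicator_of_mem (hmem.2 hξ), add_mul, neg_add,
          AddChar.map_add_eq_mul, Circle.coe_mul]
      · rw [Set.indicator_of_notMem hξ, Set.indicator_of_notMem (fun h => hξ (hmem.1 h)), mul_zero]
    have h3 : ((χ (-(ξ₀ * z)) : ℂ) - 1) * I = 0 := by linear_combination -h2
    refine (mul_eq_zero.1 h3).resolve_left fun h => h1 ?_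
    exact Circle.ext (by rw [Circle.coe_one]; linear_combination h)

lemma continuous_fourierIntegral (hχ : Continuous χ) {f : K → ℂ} (hf : Integrable f μ) :
    Continuous (fourierIntegral χ μ f) := by
  have hc := continuous_circle_coe hχ
  refine continuous_of_dominated (bound := fun x => ‖f x‖) (fun ξ => ?_) (fun ξ => ?_) hf.norm ?_
  · exact hf.1.mul (hc.comp (by fun_prop)).aestronglyMeasurable
  · exact .of_forall fun x => by rw [norm_mul, Circle.norm_coe, mul_one]
  · exact .of_forall fun x => continuous_const.mul (hc.comp (by fun_prop))

lemma integral_correlation_mul_neg (hχ : Continuous χ) {f : K → ℂ} (hf : Integrable f μ) (ξ : K) :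
    ∫ z, correlation μ f z * (χ (-(ξ * z)) : ℂ) ∂μ =
      ((‖fourierIntegral χ μ f ξ‖ ^ 2 : ℝ) : ℂ) := by
  have := integral_correlation_mul hf (χ := χ.mulShift (-ξ))
    (hχ.comp (continuous_const_mul (-ξ)))
  simpa only [AddChar.mulShift_apply, neg_mul, fourierIntegral] using this

/-- The integral of `|f̂|²` over a ball is an average of the autocorrelation of `f` over the dual
ball. -/
lemma setIntegral_norm_fourierIntegral_sq (H : IsNormalized ϖ μ) (hχ : IsBasicCharacter ϖ χ)
    {f : K → ℂ} (hf : Integrable f μ) (T : ℤ) :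
    ((∫ ξ in {ξ : K | ‖ξ‖ ≤ (residueCard K : ℝ) ^ T}, ‖fourierIntegral χ μ f ξ‖ ^ 2 ∂μ : ℝ) : ℂ) =
      ((residueCard K : ℝ) ^ T : ℝ) *
        ∫ z in {z : K | ‖z‖ ≤ (residueCard K : ℝ) ^ (-T)}, correlation μ f z ∂μ := by
  have := secondCountable_of_locallyCompact K
  rw [← integral_complex_ofReal]
  simp_rw [← integral_correlation_mul_neg hχ.1 hf]
  have hfin : IsFiniteMeasure (μ.restrict {ξ : K | ‖ξ‖ ≤ (residueCard K : ℝ) ^ T}) :=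
    ⟨by rw [Measure.restrict_apply_univ]; exact H.measure_norm_le_lt_top T⟩
  rw [integral_integral_swap]
  · simp_rw [integral_const_mul, hχ.setIntegral_norm_le H]
    rw [← integral_indicator (measurableSet_norm_le _), ← integral_const_mul]
    congr 1; ext z
    by_cases hz : z ∈ {z : K | ‖z‖ ≤ (residueCard K : ℝ) ^ (-T)}
    · rw [Set.indicator_of_mem hz, Set.indicator_of_mem hz, mul_comm]
    · rw [Set.indicator_of_notMem hz, Set.indicator_of_notMem hz, mul_zero, mul_zero]
  · have h1 := (integrable_const (μ := μ.restrict {ξ : K | ‖ξ‖ ≤ (residueCard K : ℝ) ^ T})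
      (1 : ℂ)).mul_prod (integrable_correlation hf)
    simp only [one_mul] at h1
    exact h1.mul_bdd (c := 1) ((continuous_circle_coe hχ.1).comp
      (g := fun w => (χ w : ℂ)) (f := fun P : K × K => -(P.1 * P.2))
      (by fun_prop)).aestronglyMeasurable
      (.of_forall fun x => (Circle.norm_coe _).le)

/-- Plancherel's theorem on `L¹ ∩ L²`. -/
lemma lintegral_fourierIntegral_sq (H : IsNormalized ϖ μ) (hχ : IsBasicCharacter ϖ χ)
    {f : K → ℂ} (hf : Integrable f μ) (hf2 : MemLp f 2 μ) :
    ∫⁻ ξ, ‖fourierIntegral χ μ f ξ‖ₑ ^ 2 ∂μ = ∫⁻ x, ‖f x‖ₑ ^ 2 ∂μ := by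
  set B := fun T : ℕ => {ξ : K | ‖ξ‖ ≤ (residueCard K : ℝ) ^ (T : ℤ)} with hB
  have hBm : ∀ T, MeasurableSet (B T) := fun T => measurableSet_norm_le _
  have hcont := continuous_fourierIntegral (μ := μ) hχ.1 hf
  have hq1 : (1 : ℝ) < residueCard K := by exact_mod_cast H.one_lt_q
  -- the integrals over balls increase to the full integral
  have h1 : Tendsto (fun T => ∫⁻ ξ in B T, ‖fourierIntegral χ μ f ξ‖ₑ ^ 2 ∂μ) atTop
      (𝓝 (∫⁻ ξ, ‖fourierIntegral χ μ f ξ‖ₑ ^ 2 ∂μ)) := by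
    have hmono : Monotone B := fun a b hab ξ hξ =>
      le_trans hξ (zpow_le_zpow_right₀ hq1.le (by exact_mod_cast hab))
    have hU : ⋃ T, B T = Set.univ := by
      refine Set.eq_univ_of_forall fun ξ => Set.mem_iUnion.2 ?_
      obtain ⟨n, hn⟩ := pow_unbounded_of_one_lt ‖ξ‖ hq1
      exact ⟨n, by simpa [hB] using hn.le⟩
    have := tendsto_measure_iUnion_atTop
      (μ := μ.withDensity fun ξ => ‖fourierIntegral χ μ f ξ‖ₑ ^ 2) hmono
    rw [hU, withDensity_apply _ MeasurableSet.univ, Measure.restrict_univ] at this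
    refine this.congr fun T => ?_
    rw [Function.comp_apply, withDensity_apply _ (hBm T)]
  refine tendsto_nhds_unique h1 ?_
  rw [lintegral_enorm_sq_eq_ofReal hf2]
  have h2 := H.tendsto_average_correlation hf hf2
  simp_rw [← setIntegral_norm_fourierIntegral_sq H hχ hf] at h2
  have h3 : Tendsto (fun T : ℕ => ∫ ξ in B T, ‖fourierIntegral χ μ f ξ‖ ^ 2 ∂μ) atTop
      (𝓝 (∫ x, ‖f x‖ ^ 2 ∂μ)) :=
    (Complex.continuous_re.tendsto _).comp h2
  refine (ENNReal.tendsto_ofReal h3).congr fun T => ?_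
  have hbd : ∀ ξ, ‖fourierIntegral χ μ f ξ‖ ≤ ∫ x, ‖f x‖ ∂μ := fun ξ => by
    refine (norm_integral_le_integral_norm _).trans (le_of_eq ?_)
    congr 1; ext x
    rw [norm_mul, Circle.norm_coe, mul_one]
  have hfin : IsFiniteMeasure (μ.restrict (B T)) :=
    ⟨by rw [Measure.restrict_apply_univ]; exact H.measure_norm_le_lt_top T⟩
  exact (lintegral_enorm_sq_eq_ofReal
    (MemLp.of_bound hcont.aestronglyMeasurable _ (.of_forall hbd))).symm

lemma eLpNorm_fourierIntegral (H : IsNormalized ϖ μ) (hχ : IsBasicCharacter ϖ χ)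
    {f : K → ℂ} (hf : MemLp f 1 μ) (hf2 : MemLp f 2 μ) :
    eLpNorm (fourierIntegral χ μ f) 2 μ = eLpNorm f 2 μ := by
  have := lintegral_fourierIntegral_sq H hχ (memLp_one_iff_integrable.1 hf) hf2
  rw [← eLpNorm_two_sq, ← eLpNorm_two_sq] at this
  exact (ENNReal.pow_right_strictMono two_ne_zero).injective this

lemma memLp_fourierIntegral (H : IsNormalized ϖ μ) (hχ : IsBasicCharacter ϖ χ)
    {f : K → ℂ} (hf : MemLp f 1 μ) (hf2 : MemLp f 2 μ) :
    MemLp (fourierIntegral χ μ f) 2 μ := by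
  have := secondCountable_of_locallyCompact K
  exact ⟨(continuous_fourierIntegral hχ.1 (memLp_one_iff_integrable.1 hf)).aestronglyMeasurable, by
    rw [eLpNorm_fourierIntegral H hχ hf hf2]; exact hf2.2⟩

lemma fourierIntegral_add_smul (hχ : Continuous χ) {f g : K → ℂ}
    (hf : MemLp f 1 μ) (hg : MemLp g 1 μ) (c : ℂ) :
    fourierIntegral χ μ (f + c • g) = fourierIntegral χ μ f + c • fourierIntegral χ μ g := by
  have := secondCountable_of_locallyCompact K
  have hc := continuous_circle_coe hχ
  have hi : ∀ {f : K → ℂ}, MemLp f 1 μ → ∀ ξ,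
      Integrable (fun x => f x * (χ (-(ξ * x)) : ℂ)) μ := fun hf ξ =>
    (memLp_one_iff_integrable.1 hf).mul_bdd (c := 1)
      (hc.comp (g := fun w => (χ w : ℂ)) (f := fun x => -(ξ * x))
        (by fun_prop)).aestronglyMeasurable
      (.of_forall fun x => (Circle.norm_coe _).le)
  ext ξ
  simp only [fourierIntegral, Pi.add_apply, Pi.smul_apply, smul_eq_mul]
  rw [← integral_const_mul, ← integral_add (hi hf ξ) ((hi hg ξ).const_mul c)]
  congr 1; ext x; ring

end Plancherel

/-! ### The Fourier transform on `L²` -/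

section FourierL2

variable {K : Type*} [NontriviallyNormedField K] [IsUltrametricDist K] [MeasurableSpace K]
  [BorelSpace K] [LocallyCompactSpace K] {ϖ : K} {μ : Measure K} [μ.IsAddHaarMeasure]
  {χ : AddChar K Circle}

/-- Every square integrable function has a Fourier transform, so the default value in the definition
of `fourierL2` is not taken. -/
lemma exists_isFourierTransform (H : IsNormalized ϖ μ) (hχ : IsBasicCharacter ϖ χ) {f : K → ℂ}
    (hf : MemLp f 2 μ) : ∃ g, IsFourierTransform χ μ f g := by
  have hpos : ∀ n : ℕ, ((n : ℝ≥0∞) + 1)⁻¹ ≠ 0 := fun n => by simp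
  choose F hF hF2 using fun n : ℕ => hf.exists_simpleFunc_eLpNorm_sub_lt (by simp) (hpos n)
  have hF1 : ∀ n, MemLp (F n) 1 μ := fun n =>
    memLp_one_iff_integrable.2 ((SimpleFunc.memLp_iff_integrable (by simp) (by simp)).1 (hF2 n))
  have hFF := fun n => memLp_fourierIntegral H hχ (hF1 n) (hF2 n)
  have hlim : Tendsto (fun n => eLpNorm (⇑(F n) - f) 2 μ) atTop (𝓝 0) := by
    have h0 : Tendsto (fun n : ℕ => ((n : ℝ≥0∞) + 1)⁻¹) atTop (𝓝 0) := by
      have := (tendsto_add_atTop_iff_nat 1).2 ENNReal.tendsto_inv_nat_nhds_zero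
      simpa using this
    refine tendsto_of_tendsto_of_tendsto_of_le_of_le tendsto_const_nhds h0 (fun _ => zero_le)
      fun n => ?_
    rw [eLpNorm_sub_comm]
    exact (hF n).le
  -- the transforms form a Cauchy sequence, as the Fourier integral is isometric
  have hC : CauchySeq fun n => (hFF n).toLp _ := by
    have h1 : CauchySeq fun n => (hF2 n).toLp _ :=
      (((Lp.tendsto_Lp_iff_tendsto_eLpNorm'' _ hF2 f hf).2 hlim)).cauchySeq
    rw [EMetric.cauchySeq_iff] at h1 ⊢
    intro e he
    obtain ⟨N, hN⟩ := h1 e he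
    refine ⟨N, fun m hm n hn => ?_⟩
    have h2 := hN m hm n hn
    rw [Lp.edist_toLp_toLp] at h2 ⊢
    have h3 := fourierIntegral_add_smul (μ := μ) hχ.1 (hF1 m) (hF1 n) (-1)
    rw [neg_one_smul, neg_one_smul, ← sub_eq_add_neg, ← sub_eq_add_neg] at h3
    rw [← h3, eLpNorm_fourierIntegral H hχ ((hF1 m).sub (hF1 n)) ((hF2 m).sub (hF2 n))]
    exact h2
  obtain ⟨g, hg⟩ := cauchySeq_tendsto_of_complete hC
  refine ⟨g, hf, Lp.memLp g, fun n => F n, fun n => ⟨hF1 n, hF2 n⟩, hlim, ?_⟩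
  have h1 : (Lp.memLp g).toLp g = g := Lp.toLp_coeFn g _
  rw [← h1] at hg
  exact (Lp.tendsto_Lp_iff_tendsto_eLpNorm'' _ hFF g (Lp.memLp g)).1 hg

lemma isFourierTransform_fourierL2 (H : IsNormalized ϖ μ) (hχ : IsBasicCharacter ϖ χ) {f : K → ℂ}
    (hf : MemLp f 2 μ) : IsFourierTransform χ μ f (fourierL2 χ μ f) := by
  have h := exists_isFourierTransform H hχ hf
  rw [fourierL2, dif_pos h]
  exact h.choose_spec

lemma isFourierTransform_fourierIntegral (H : IsNormalized ϖ μ) (hχ : IsBasicCharacter ϖ χ)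
    {f : K → ℂ} (hf : MemLp f 1 μ) (hf2 : MemLp f 2 μ) :
    IsFourierTransform χ μ f (fourierIntegral χ μ f) :=
  ⟨hf2, memLp_fourierIntegral H hχ hf hf2, fun _ => f, fun _ => ⟨hf, hf2⟩, by simp, by simp⟩

namespace IsFourierTransform

lemma congr {f f' g g' : K → ℂ} (h : IsFourierTransform χ μ f g) (hf : f =ᵐ[μ] f')
    (hg : g =ᵐ[μ] g') : IsFourierTransform χ μ f' g' := by
  obtain ⟨h1, h2, F, hF, hl, hl'⟩ := h
  refine ⟨h1.ae_eq hf, h2.ae_eq hg, F, hF, hl.congr fun n => ?_, hl'.congr fun n => ?_⟩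
  · exact eLpNorm_congr_ae (.sub .rfl hf)
  · exact eLpNorm_congr_ae (.sub .rfl hg)

lemma norm_toLp_eq (H : IsNormalized ϖ μ) (hχ : IsBasicCharacter ϖ χ) {f g : K → ℂ}
    (h : IsFourierTransform χ μ f g) : ‖h.1.toLp f‖ = ‖h.2.1.toLp g‖ := by
  obtain ⟨h1, h2, F, hF, hl, hl'⟩ := h
  have hFF := fun n => memLp_fourierIntegral H hχ (hF n).1 (hF n).2
  have t1 := ((Lp.tendsto_Lp_iff_tendsto_eLpNorm'' _ (fun n => (hF n).2) f h1).2 hl).norm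
  have t2 := ((Lp.tendsto_Lp_iff_tendsto_eLpNorm'' _ hFF g h2).2 hl').norm
  refine tendsto_nhds_unique (t1.congr fun n => ?_) t2
  rw [Lp.norm_toLp, Lp.norm_toLp, eLpNorm_fourierIntegral H hχ (hF n).1 (hF n).2]

lemma eLpNorm_eq (H : IsNormalized ϖ μ) (hχ : IsBasicCharacter ϖ χ) {f g : K → ℂ}
    (h : IsFourierTransform χ μ f g) : eLpNorm g 2 μ = eLpNorm f 2 μ := by
  have := h.norm_toLp_eq H hχ
  rw [Lp.norm_toLp, Lp.norm_toLp] at this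
  exact ((ENNReal.toReal_eq_toReal_iff' h.1.2.ne h.2.1.2.ne).1 this).symm

lemma add_smul (H : IsNormalized ϖ μ) (hχ : IsBasicCharacter ϖ χ) {f f' g g' : K → ℂ}
    (h : IsFourierTransform χ μ f g) (h' : IsFourierTransform χ μ f' g') (c : ℂ) :
    IsFourierTransform χ μ (f + c • f') (g + c • g') := by
  obtain ⟨h1, h2, F, hF, hl, hl'⟩ := h
  obtain ⟨k1, k2, G, hG, kl, kl'⟩ := h'
  have key : ∀ {A B : ℕ → K → ℂ} {a b : K → ℂ}, (∀ n, MemLp (A n) 2 μ) → (∀ n, MemLp (B n) 2 μ) →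
      MemLp a 2 μ → MemLp b 2 μ →
      Tendsto (fun n => eLpNorm (A n - a) 2 μ) atTop (𝓝 0) →
      Tendsto (fun n => eLpNorm (B n - b) 2 μ) atTop (𝓝 0) →
      Tendsto (fun n => eLpNorm (A n + c • B n - (a + c • b)) 2 μ) atTop (𝓝 0) := by
    intro A B a b hA hB ha hb tA tB
    have h0 : Tendsto (fun n => eLpNorm (A n - a) 2 μ + ‖c‖ₑ * eLpNorm (B n - b) 2 μ) atTop
        (𝓝 0) := by
      simpa using tA.add (ENNReal.Tendsto.const_mul (a := ‖c‖ₑ) tB (Or.inr enorm_ne_top))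
    refine tendsto_of_tendsto_of_tendsto_of_le_of_le tendsto_const_nhds h0 (fun _ => zero_le)
      fun n => ?_
    have : A n + c • B n - (a + c • b) = (A n - a) + c • (B n - b) := by
      rw [smul_sub]; abel
    simp only [this]
    refine (eLpNorm_add_le ((hA n).sub ha).1 (((hB n).sub hb).const_smul c).1 (by simp)).trans ?_
    rw [eLpNorm_const_smul]
  refine ⟨h1.add (k1.const_smul c), h2.add (k2.const_smul c), fun n => F n + c • G n,
    fun n => ⟨(hF n).1.add ((hG n).1.const_smul c), (hF n).2.add ((hG n).2.const_smul c)⟩,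
    key (fun n => (hF n).2) (fun n => (hG n).2) h1 k1 hl kl, ?_⟩
  simp_rw [fun n => fourierIntegral_add_smul (μ := μ) hχ.1 (hF n).1 (hG n).1 c]
  exact key (fun n => memLp_fourierIntegral H hχ (hF n).1 (hF n).2)
    (fun n => memLp_fourierIntegral H hχ (hG n).1 (hG n).2) h2 k2 hl' kl'

lemma ae_unique (H : IsNormalized ϖ μ) (hχ : IsBasicCharacter ϖ χ) {f g g' : K → ℂ}
    (h : IsFourierTransform χ μ f g) (h' : IsFourierTransform χ μ f g') : g =ᵐ[μ] g' := by
  have h1 := (h.add_smul H hχ h' (-1)).eLpNorm_eq H hχ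
  rw [neg_one_smul, neg_one_smul, ← sub_eq_add_neg, ← sub_eq_add_neg, sub_self, eLpNorm_zero,
    eLpNorm_eq_zero_iff (h.2.1.sub h'.2.1).1 two_ne_zero] at h1
  filter_upwards [h1] with x hx
  simpa [sub_eq_zero] using hx

/-- Parseval's identity, obtained from Plancherel's by polarization. -/
lemma integral_mul_conj (H : IsNormalized ϖ μ) (hχ : IsBasicCharacter ϖ χ) {f f' g g' : K → ℂ}
    (h : IsFourierTransform χ μ f g) (h' : IsFourierTransform χ μ f' g') :
    ∫ x, f x * (starRingEnd ℂ) (f' x) ∂μ = ∫ x, g x * (starRingEnd ℂ) (g' x) ∂μ := by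
  have hin : ∀ {a b : K → ℂ} (ha : MemLp a 2 μ) (hb : MemLp b 2 μ),
      ∫ x, a x * (starRingEnd ℂ) (b x) ∂μ = inner ℂ (hb.toLp b) (ha.toLp a) := by
    intro a b ha hb
    rw [L2.inner_def]
    refine integral_congr_ae ?_
    filter_upwards [ha.coeFn_toLp, hb.coeFn_toLp] with x hx hx'
    rw [hx, hx', RCLike.inner_apply]
  have hn : ∀ c : ℂ, ‖h'.1.toLp f' + c • h.1.toLp f‖ = ‖h'.2.1.toLp g' + c • h.2.1.toLp g‖ :=
    fun c => (h'.add_smul H hχ h c).norm_toLp_eq H hχ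
  rw [hin h.1 h'.1, hin h.2.1 h'.2.1, inner_eq_sum_norm_sq_div_four,
    inner_eq_sum_norm_sq_div_four]
  have e1 := hn 1
  have e2 := hn (-1)
  have e3 := hn Complex.I
  have e4 := hn (-Complex.I)
  simp only [one_smul, neg_smul, ← sub_eq_add_neg] at e1 e2 e3 e4
  simp only [RCLike.I_to_complex, e1, e2, e3, e4]

end IsFourierTransform

end FourierL2

/-! ### Transforms of balls and of affine systems -/

section FourierAffine

variable {K : Type*} [NontriviallyNormedField K] [IsUltrametricDist K] [MeasurableSpace K]
  [BorelSpace K] [LocallyCompactSpace K] {ϖ : K} {μ : Measure K} [μ.IsAddHaarMeasure]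
  {χ : AddChar K Circle}

/-- The transform of the indicator function of a ball is a multiple of that of the dual ball. -/
lemma exists_isFourierTransform_indicator (H : IsNormalized ϖ μ) (hχ : IsBasicCharacter ϖ χ)
    (T : ℤ) : ∃ f, IsFourierTransform χ μ f ({ξ : K | ‖ξ‖ ≤ (residueCard K : ℝ) ^ T}.indicator
      fun _ => (((residueCard K : ℝ) ^ (-T) : ℝ) : ℂ)) := by
  set B := {x : K | ‖x‖ ≤ (residueCard K : ℝ) ^ (-T)} with hB
  have hBm : MeasurableSet B := measurableSet_norm_le _
  have hm : ∀ r : ℝ≥0∞, MemLp (B.indicator fun _ => (1 : ℂ)) r μ := fun r =>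
    memLp_indicator_const r hBm 1 (Or.inr (H.measure_norm_le_lt_top _).ne)
  refine ⟨B.indicator fun _ => (1 : ℂ),
    (isFourierTransform_fourierIntegral H hχ (hm 1) (hm 2)).congr .rfl (.of_eq ?_)⟩
  ext ξ
  have h1 := hχ.setIntegral_norm_le H (-T) ξ
  rw [neg_neg] at h1
  rw [← h1, fourierIntegral, ← integral_indicator hBm]
  congr 1; ext x
  by_cases hx : x ∈ B
  · rw [Set.indicator_of_mem hx, Set.indicator_of_mem hx, one_mul, mul_comm]
  · rw [Set.indicator_of_notMem hx, Set.indicator_of_notMem hx, zero_mul]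

lemma IsNormalized.measurableEmbedding_mul_sub (H : IsNormalized ϖ μ) (j : ℤ) (b : K) :
    MeasurableEmbedding (fun x : K => ϖ ^ j * x - b) :=
  ((Homeomorph.mulLeft₀ (ϖ ^ j) (zpow_ne_zero _ H.prime.ne_zero)).trans
    (Homeomorph.subRight b)).measurableEmbedding

lemma IsNormalized.map_mul_sub (H : IsNormalized ϖ μ) (j : ℤ) (b : K) :
    μ.map (fun x => ϖ ^ j * x - b) = (residueCard K : ℝ≥0∞) ^ j • μ := by
  have : (fun x => ϖ ^ j * x - b) = (fun y => y - b) ∘ fun x => ϖ ^ j * x := rfl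
  rw [this, ← Measure.map_map (measurable_sub_const b) (measurable_const_mul _), H.map_mul,
    Measure.map_smul, (measurePreserving_sub_right μ b).map_eq]

lemma IsNormalized.eLpNorm_comp_mul_sub (H : IsNormalized ϖ μ) (j : ℤ) (b : K) {r : ℝ≥0∞}
    (hr : r ≠ ∞) (f : K → ℂ) :
    eLpNorm (fun x => f (ϖ ^ j * x - b)) r μ =
      ((residueCard K : ℝ≥0∞) ^ j) ^ (1 / r).toReal * eLpNorm f r μ := by
  have := (H.measurableEmbedding_mul_sub j b).eLpNorm_map_measure (g := f) (p := r) (μ := μ)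
  rw [H.map_mul_sub, eLpNorm_smul_measure_of_ne_top hr, smul_eq_mul] at this
  exact this.symm

lemma IsNormalized.memLp_comp_mul_sub (H : IsNormalized ϖ μ) (j : ℤ) (b : K) {r : ℝ≥0∞}
    {f : K → ℂ} (hf : MemLp f r μ) : MemLp (fun x => f (ϖ ^ j * x - b)) r μ := by
  have h1 : MemLp f r (μ.map (fun x => ϖ ^ j * x - b)) := by
    rw [H.map_mul_sub]
    exact hf.smul_measure (ENNReal.zpow_ne_top H.q_ne_zero (by simp) _)
  exact (H.measurableEmbedding_mul_sub j b).memLp_map_measure_iff.1 h1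

lemma fourierIntegral_affine (H : IsNormalized ϖ μ) (u : ℕ → K) (f : K → ℂ) (j : ℤ) (t : ℕ)
    (ξ : K) :
    fourierIntegral χ μ (affine ϖ u f j t) ξ =
      (((residueCard K : ℝ) ^ (-(j : ℝ) / 2) : ℝ) : ℂ) * (χ (-(u t * (ϖ ^ j * ξ))) : ℂ) *
        fourierIntegral χ μ f (ϖ ^ j * ξ) := by
  have hϖ : ϖ ^ j * ϖ ^ (-j) = 1 := by
    rw [← zpow_add₀ H.prime.ne_zero, add_neg_cancel, zpow_zero]
  set c : ℝ := (residueCard K : ℝ) ^ ((j : ℝ) / 2) with hc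
  have h1 : fourierIntegral χ μ (affine ϖ u f j t) ξ =
      ∫ x, (fun y => (c : ℂ) * f (y - u t) * (χ (-(ϖ ^ j * ξ * y)) : ℂ)) (ϖ ^ (-j) * x) ∂μ := by
    rw [fourierIntegral]
    congr 1; ext x
    simp only [affine]
    have : ϖ ^ j * ξ * (ϖ ^ (-j) * x) = ξ * x := by linear_combination (ξ * x) * hϖ
    rw [this]
  refine h1.trans ((H.integral_comp_mul (-j)
    (fun y => (c : ℂ) * f (y - u t) * (χ (-(ϖ ^ j * ξ * y)) : ℂ))).trans ?_)
  rw [← integral_add_right_eq_self _ (u t)]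
  simp only [add_sub_cancel_right, mul_add, neg_add, AddChar.map_add_eq_mul, Circle.coe_mul]
  have h2 : ∀ y : K, (c : ℂ) * f y * ((χ (-(ϖ ^ j * ξ * y)) : ℂ) * (χ (-(ϖ ^ j * ξ * u t)) : ℂ)) =
      (c * (χ (-(u t * (ϖ ^ j * ξ))) : ℂ)) * (f y * (χ (-(ϖ ^ j * ξ * y)) : ℂ)) := fun y => by
    rw [mul_comm (u t)]; ring
  simp_rw [h2, integral_const_mul]
  rw [fourierIntegral, ← mul_assoc, ← mul_assoc, ← Complex.ofReal_mul]
  congr 4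
  rw [hc, ← Real.rpow_intCast, ← Real.rpow_add H.q_pos]
  congr 1; push_cast; ring

lemma IsFourierTransform.affine (H : IsNormalized ϖ μ) (hχ : IsBasicCharacter ϖ χ)
    {f g : K → ℂ} (h : IsFourierTransform χ μ f g) (u : ℕ → K) (j : ℤ) (t : ℕ) :
    IsFourierTransform χ μ (affine ϖ u f j t) (fun ξ =>
      (((residueCard K : ℝ) ^ (-(j : ℝ) / 2) : ℝ) : ℂ) * (χ (-(u t * (ϖ ^ j * ξ))) : ℂ) *
        g (ϖ ^ j * ξ)) := by
  obtain ⟨h1, h2, F, hF, hl, hl'⟩ := h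
  have := secondCountable_of_locallyCompact K
  have hA : ∀ {r : ℝ≥0∞} {a : K → ℂ}, MemLp a r μ →
      MemLp (LocalFieldWavelet.affine ϖ u a j t) r μ := fun ha =>
    (H.memLp_comp_mul_sub (-j) (u t) ha).const_mul _
  set c : ℂ := (((residueCard K : ℝ) ^ (-(j : ℝ) / 2) : ℝ) : ℂ)
  have hmeas : AEStronglyMeasurable (fun ξ => (χ (-(u t * (ϖ ^ j * ξ))) : ℂ)) μ :=
    ((continuous_circle_coe hχ.1).comp (g := fun w => (χ w : ℂ))
      (f := fun ξ => -(u t * (ϖ ^ j * ξ))) (by fun_prop)).aestronglyMeasurable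
  have hq : ∀ (i : ℤ) (s : ℝ), 0 ≤ s → ((residueCard K : ℝ≥0∞) ^ i) ^ s ≠ ∞ := fun i s hs =>
    ENNReal.rpow_ne_top_of_nonneg hs (ENNReal.zpow_ne_top H.q_ne_zero (by simp) _)
  have hz : ∀ a : ℕ → ℝ≥0∞, Tendsto a atTop (𝓝 0) → ∀ b : ℝ≥0∞, b ≠ ∞ → ∀ d : ℝ≥0∞, d ≠ ∞ →
      Tendsto (fun n => d * (b * a n)) atTop (𝓝 0) := fun a ha b hb d hd => by
    simpa using ENNReal.Tendsto.const_mul (a := d)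
      (ENNReal.Tendsto.const_mul (a := b) ha (Or.inr hb)) (Or.inr hd)
  refine ⟨hA h1, ?_, fun n => LocalFieldWavelet.affine ϖ u (F n) j t,
    fun n => ⟨hA (hF n).1, hA (hF n).2⟩, ?_, ?_⟩
  · have h3 := H.memLp_comp_mul_sub j 0 h2
    simp only [sub_zero] at h3
    refine (h3.const_mul c).of_le ((aestronglyMeasurable_const.mul hmeas).mul h3.1)
      (.of_forall fun ξ => le_of_eq ?_)
    rw [norm_mul, norm_mul, norm_mul, Circle.norm_coe, mul_one]
  · have h3 : ∀ n, eLpNorm (LocalFieldWavelet.affine ϖ u (F n) j t -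
        LocalFieldWavelet.affine ϖ u f j t) 2 μ =
        ‖(((residueCard K : ℝ) ^ ((j : ℝ) / 2) : ℝ) : ℂ)‖ₑ *
          (((residueCard K : ℝ≥0∞) ^ (-j)) ^ (1 / (2 : ℝ≥0∞)).toReal * eLpNorm (F n - f) 2 μ) :=
      fun n => by
      rw [← H.eLpNorm_comp_mul_sub (-j) (u t) (by simp), ← eLpNorm_const_smul]
      congr 1; ext x
      simp only [LocalFieldWavelet.affine, Pi.sub_apply, Pi.smul_apply, smul_eq_mul]
      ring
    refine (hz _ hl _ (hq (-j) _ ENNReal.toReal_nonneg) _ enorm_ne_top).congr fun n => (h3 n).symm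
  · have h3 : ∀ n, eLpNorm (fourierIntegral χ μ (LocalFieldWavelet.affine ϖ u (F n) j t) -
        fun ξ => c * (χ (-(u t * (ϖ ^ j * ξ))) : ℂ) * g (ϖ ^ j * ξ)) 2 μ =
        ‖c‖ₑ * (((residueCard K : ℝ≥0∞) ^ j) ^ (1 / (2 : ℝ≥0∞)).toReal *
          eLpNorm (fourierIntegral χ μ (F n) - g) 2 μ) := fun n => by
      rw [← H.eLpNorm_comp_mul_sub j 0 (by simp), ← eLpNorm_const_smul]
      refine eLpNorm_congr_norm_ae (.of_forall fun ξ => ?_)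
      simp only [Pi.sub_apply, Pi.smul_apply, smul_eq_mul, sub_zero, fourierIntegral_affine H]
      rw [← mul_sub, norm_mul, norm_mul, norm_mul, Circle.norm_coe, mul_one]
    refine (hz _ hl' _ (hq j _ ENNReal.toReal_nonneg) _ enorm_ne_top).congr fun n => (h3 n).symm

end FourierAffine

/-! ### The Dirichlet kernel of the translations -/

section Kernel

lemma sum_range_prod_digits {m n : ℕ} (g : Fin n → ℕ → ℂ) :
    ∑ t ∈ Finset.range (m ^ n), ∏ k : Fin n, g k (t / m ^ (k : ℕ) % m) =
      ∏ k : Fin n, ∑ b ∈ Finset.range m, g k b := by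
  classical
  simp_rw [Finset.sum_range]
  rw [Finset.prod_univ_sum, Fintype.piFinset_univ]
  exact finFunctionFinEquiv.symm.sum_comp (fun a : Fin n → Fin m => ∏ k, g k (a k))

lemma sum_range_pow_root_of_unity {p : ℕ} {w : ℂ} (hw : w ^ p = 1) :
    ∃ r : ℝ, 0 ≤ r ∧ ∑ a ∈ Finset.range p, w ^ a = r := by
  by_cases h : w = 1
  · exact ⟨p, Nat.cast_nonneg p, by simp [h]⟩
  · exact ⟨0, le_rfl, by rw [geom_sum_eq h, hw]; simp⟩

lemma exists_prod_eq_ofReal {ι : Type*} (s : Finset ι) {f : ι → ℂ}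
    (h : ∀ i ∈ s, ∃ r : ℝ, 0 ≤ r ∧ f i = r) : ∃ r : ℝ, 0 ≤ r ∧ ∏ i ∈ s, f i = r := by
  choose! r hr hf using h
  exact ⟨∏ i ∈ s, r i, Finset.prod_nonneg hr, by
    rw [Complex.ofReal_prod]; exact Finset.prod_congr rfl hf⟩

variable {K : Type*} [NontriviallyNormedField K] [IsUltrametricDist K]

lemma translationDigit_zero (p : ℕ) {c : ℕ} (ε : Fin c → K) (ϖ : K) :
    translationDigit p ε ϖ 0 = 0 := by
  simp [translationDigit]

/-- The defining sum of `u(n)` may be cut off at any number of digits sufficient for `n`. -/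
lemma translation_eq_sum (hq : 1 < residueCard K) (p : ℕ) {c : ℕ} (ε : Fin c → K) (ϖ : K)
    {n N : ℕ} (hn : n < residueCard K ^ N) :
    translation p ε ϖ n = ∑ k ∈ Finset.range N, ϖ ^ (-(k : ℤ)) *
      translationDigit p ε ϖ (n / residueCard K ^ k % residueCard K) := by
  have key : ∀ {N M : ℕ}, n < residueCard K ^ N → N ≤ M →
      ∑ k ∈ Finset.range N, ϖ ^ (-(k : ℤ)) *
        translationDigit p ε ϖ (n / residueCard K ^ k % residueCard K) =
      ∑ k ∈ Finset.range M, ϖ ^ (-(k : ℤ)) *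
        translationDigit p ε ϖ (n / residueCard K ^ k % residueCard K) := by
    intro N M hN hNM
    refine Finset.sum_subset (Finset.range_mono hNM) fun k _ hk => ?_
    have hk' : N ≤ k := by simpa using hk
    rw [Nat.div_eq_of_lt (hN.trans_le (Nat.pow_le_pow_right (by omega) hk')), Nat.zero_mod,
      translationDigit_zero, mul_zero]
  have h1 : n < residueCard K ^ (n + 1) :=
    (Nat.lt_pow_self hq).trans_le (Nat.pow_le_pow_right (by omega) (Nat.le_succ n))
  rw [translation, key h1 (le_max_left (n + 1) N), key hn (le_max_right (n + 1) N)]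

lemma addChar_sum {ι : Type*} (χ : AddChar K Circle) (s : Finset ι) (f : ι → K) :
    (χ (∑ i ∈ s, f i) : ℂ) = ∏ i ∈ s, (χ (f i) : ℂ) := by
  classical
  induction s using Finset.induction_on with
  | empty => simp
  | insert a s ha ih =>
    rw [Finset.sum_insert ha, Finset.prod_insert ha, AddChar.map_add_eq_mul, Circle.coe_mul, ih]

/-- `c` is the degree of the residue field over its prime field. -/
lemma IsResidueBasis.residueCard_eq {p c : ℕ} {ε : Fin c → ringOfIntegers K}
    (hε : IsResidueBasis p ε) : residueCard K = p ^ c := by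
  rw [residueCard, ← Nat.card_eq_of_bijective _ hε.2]
  simp

/-- Because `p = 0` in `K`, the sum `∑_{t < q ^ T} χ(u(t) z)` is a product of sums over `p`-th roots
of unity, hence a nonnegative real number. -/
lemma sum_addChar_translation_nonneg {p : ℕ} [CharP K p] {c : ℕ} {ε : Fin c → ringOfIntegers K}
    (hε : IsResidueBasis p ε) (hq : 1 < residueCard K) (ϖ : K) (χ : AddChar K Circle) (T : ℕ)
    (z : K) : ∃ r : ℝ, 0 ≤ r ∧ ∑ t ∈ Finset.range (residueCard K ^ T),
      (χ (translation p (fun k => (ε k : K)) ϖ t * z) : ℂ) = r := by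
  set d := translationDigit p (fun k => (ε k : K)) ϖ with hd
  obtain ⟨g, hg⟩ : ∃ g : Fin T → ℕ → ℂ,
      ∀ k b, g k b = (χ (ϖ ^ (-((k : ℕ) : ℤ)) * d b * z) : ℂ) := ⟨_, fun _ _ => rfl⟩
  have h1 : ∑ t ∈ Finset.range (residueCard K ^ T),
      (χ (translation p (fun k => (ε k : K)) ϖ t * z) : ℂ) =
      ∑ t ∈ Finset.range (residueCard K ^ T), ∏ k : Fin T,
        g k (t / residueCard K ^ (k : ℕ) % residueCard K) := by
    refine Finset.sum_congr rfl fun t ht => ?_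
    rw [translation_eq_sum hq p _ ϖ (Finset.mem_range.1 ht), Finset.sum_mul, addChar_sum,
      Finset.prod_range]
    simp only [hg, hd]
  rw [h1, sum_range_prod_digits]
  refine exists_prod_eq_ofReal _ fun k _ => ?_
  obtain ⟨w, hw⟩ : ∃ w : Fin c → ℂ,
      ∀ i, w i = (χ (ϖ ^ (-((k : ℕ) : ℤ)) * ε i * ϖ⁻¹ * z) : ℂ) := ⟨_, fun _ => rfl⟩
  have h2 : ∀ b : ℕ, g k b = ∏ i : Fin c, w i ^ (b / p ^ (i : ℕ) % p) := by
    intro b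
    have h3 : ϖ ^ (-((k : ℕ) : ℤ)) * d b * z = ∑ i : Fin c,
        (b / p ^ (i : ℕ) % p) • (ϖ ^ (-((k : ℕ) : ℤ)) * ε i * ϖ⁻¹ * z) := by
      rw [hd, translationDigit, Finset.sum_mul, Finset.mul_sum, Finset.sum_mul]
      refine Finset.sum_congr rfl fun i _ => ?_
      rw [nsmul_eq_mul]; ring
    rw [hg, h3, addChar_sum]
    refine Finset.prod_congr rfl fun i _ => ?_
    rw [hw, AddChar.map_nsmul_eq_pow, Circle.coe_pow]
  simp_rw [h2]
  rw [hε.residueCard_eq, sum_range_prod_digits (fun i a => w i ^ a)]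
  refine exists_prod_eq_ofReal _ fun i _ => sum_range_pow_root_of_unity ?_
  rw [hw, ← Circle.coe_pow, ← AddChar.map_nsmul_eq_pow, nsmul_eq_mul, CharP.cast_eq_zero, zero_mul,
    AddChar.map_zero_eq_one, Circle.coe_one]

lemma norm_natCast_le_one (n : ℕ) : ‖(n : K)‖ ≤ 1 := by
  induction n with
  | zero => simp
  | succ n ih =>
    rw [Nat.cast_succ]
    exact (IsUltrametricDist.norm_add_le_max _ _).trans (max_le ih norm_one.le)

lemma norm_translation_le {ϖ : K} (hϖ : IsPrimeElement ϖ)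
    (hnorm : ‖ϖ‖ = (residueCard K : ℝ)⁻¹) {p c : ℕ} (ε : Fin c → ringOfIntegers K) {t T : ℕ}
    (ht : t < residueCard K ^ T) :
    ‖translation p (fun k => (ε k : K)) ϖ t‖ ≤ (residueCard K : ℝ) ^ (T : ℤ) := by
  have hq := one_lt_residueCard hϖ hnorm
  have hq0 : (0 : ℝ) < residueCard K := by exact_mod_cast zero_lt_one.trans hq
  rw [translation_eq_sum hq p _ ϖ ht]
  refine IsUltrametricDist.norm_sum_le_of_forall_le_of_nonneg (zpow_pos hq0 _).le fun k hk => ?_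
  have hd : ∀ b, ‖translationDigit p (fun k => (ε k : K)) ϖ b‖ ≤ residueCard K := by
    intro b
    rw [translationDigit, norm_mul, norm_inv, hnorm, inv_inv]
    refine mul_le_of_le_one_left hq0.le
      (IsUltrametricDist.norm_sum_le_of_forall_le_of_nonneg zero_le_one fun i _ => ?_)
    rw [norm_mul]
    have h1 : ‖(ε i : K)‖ ≤ 1 := (ε i).2
    exact mul_le_one₀ (norm_natCast_le_one _) (norm_nonneg _) h1
  rw [norm_mul, norm_zpow, hnorm, inv_zpow', neg_neg]
  have hk' : k + 1 ≤ T := Finset.mem_range.1 hk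
  calc _ ≤ (residueCard K : ℝ) ^ (k : ℤ) * residueCard K :=
        mul_le_mul_of_nonneg_left (hd _) (zpow_pos hq0 _).le
    _ = (residueCard K : ℝ) ^ ((k : ℤ) + 1) := (zpow_add_one₀ hq0.ne' _).symm
    _ ≤ _ := zpow_le_zpow_right₀ (by exact_mod_cast hq.le) (by exact_mod_cast hk')

lemma sum_addChar_translation_of_norm_le {ϖ : K} (hϖ : IsPrimeElement ϖ)
    (hnorm : ‖ϖ‖ = (residueCard K : ℝ)⁻¹) {χ : AddChar K Circle} (hχ : IsBasicCharacter ϖ χ)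
    {p c : ℕ} (ε : Fin c → ringOfIntegers K) {T : ℕ} {z : K}
    (hz : ‖z‖ ≤ (residueCard K : ℝ) ^ (-(T : ℤ))) :
    ∑ t ∈ Finset.range (residueCard K ^ T),
      (χ (translation p (fun k => (ε k : K)) ϖ t * z) : ℂ) =
        (((residueCard K : ℝ) ^ (T : ℤ) : ℝ) : ℂ) := by
  have hq0 : (0 : ℝ) < residueCard K := by
    exact_mod_cast zero_lt_one.trans (one_lt_residueCard hϖ hnorm)
  have h1 : ∀ t ∈ Finset.range (residueCard K ^ T),
      (χ (translation p (fun k => (ε k : K)) ϖ t * z) : ℂ) = 1 := by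
    intro t ht
    have : ‖translation p (fun k => (ε k : K)) ϖ t * z‖ ≤ 1 := by
      rw [norm_mul]
      calc _ ≤ (residueCard K : ℝ) ^ (T : ℤ) * (residueCard K : ℝ) ^ (-(T : ℤ)) :=
            mul_le_mul (norm_translation_le hϖ hnorm ε (Finset.mem_range.1 ht)) hz (norm_nonneg _)
              (zpow_pos hq0 _).le
        _ = 1 := by rw [← zpow_add₀ hq0.ne', add_neg_cancel, zpow_zero]
    rw [hχ.2.1 _ this, Circle.coe_one]
  rw [Finset.sum_congr rfl h1]
  simp

end Kernel

/-! ### Bessel's inequality for the indicator function forces Parseval's identity -/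

section Parseval

variable {K : Type*} [NontriviallyNormedField K] [IsUltrametricDist K] [MeasurableSpace K]
  [BorelSpace K] [LocallyCompactSpace K] {ϖ : K} {μ : Measure K} [μ.IsAddHaarMeasure]
  {χ : AddChar K Circle} {u : ℕ → K}

lemma integrable_correlation_mul_sum (hχ : Continuous χ) {h : K → ℂ} (hh : Integrable h μ)
    (s : Finset ℕ) :
    Integrable (fun z => correlation μ h z * ∑ t ∈ s, (χ (u t * z) : ℂ)) μ := by
  have := secondCountable_of_locallyCompact K
  simp_rw [Finset.mul_sum]
  exact integrable_finsetSum _ fun t _ => (integrable_correlation hh).mul_bdd (c := 1)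
    ((continuous_circle_coe hχ).comp (g := fun w => (χ w : ℂ)) (f := fun z => u t * z)
      (by fun_prop)).aestronglyMeasurable
    (.of_forall fun x => (Circle.norm_coe _).le)

lemma sum_norm_integral_sq (hχ : Continuous χ) {h : K → ℂ} (hh : Integrable h μ)
    (s : Finset ℕ) :
    ((∑ t ∈ s, ‖∫ x, h x * (χ (u t * x) : ℂ) ∂μ‖ ^ 2 : ℝ) : ℂ) =
      ∫ z, correlation μ h z * ∑ t ∈ s, (χ (u t * z) : ℂ) ∂μ := by
  simp_rw [Finset.mul_sum]
  rw [integral_finsetSum, Complex.ofReal_sum]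
  · refine Finset.sum_congr rfl fun t _ => ?_
    exact (integral_correlation_mul hh (χ := χ.mulShift (u t))
      (hχ.comp (continuous_const_mul (u t)))).symm
  · intro t _
    simpa using integrable_correlation_mul_sum (u := u) hχ hh {t}

/-- The sum over `t < q ^ T` is the sum of the average of the autocorrelation over the ball of
radius `q ^ (-T)` and of an error term outside of this ball. -/
lemma sum_norm_integral_sq_eq_add (hχ : Continuous χ)
    (hD : ∀ (T : ℕ) (z : K), ‖z‖ ≤ (residueCard K : ℝ) ^ (-(T : ℤ)) →
      ∑ t ∈ Finset.range (residueCard K ^ T), (χ (u t * z) : ℂ) =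
        (((residueCard K : ℝ) ^ (T : ℤ) : ℝ) : ℂ)) {h : K → ℂ} (hh : Integrable h μ) (T : ℕ) :
    ((∑ t ∈ Finset.range (residueCard K ^ T), ‖∫ x, h x * (χ (u t * x) : ℂ) ∂μ‖ ^ 2 : ℝ) : ℂ) =
      ((residueCard K : ℝ) ^ (T : ℤ) : ℝ) *
          ∫ z in {z : K | ‖z‖ ≤ (residueCard K : ℝ) ^ (-(T : ℤ))}, correlation μ h z ∂μ +
        ∫ z in {z : K | ‖z‖ ≤ (residueCard K : ℝ) ^ (-(T : ℤ))}ᶜ, correlation μ h z *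
          ∑ t ∈ Finset.range (residueCard K ^ T), (χ (u t * z) : ℂ) ∂μ := by
  set B := {z : K | ‖z‖ ≤ (residueCard K : ℝ) ^ (-(T : ℤ))} with hB
  have hBm : MeasurableSet B := measurableSet_norm_le _
  rw [sum_norm_integral_sq hχ hh,
    ← integral_add_compl hBm (integrable_correlation_mul_sum hχ hh _), ← integral_const_mul]
  congr 1
  refine setIntegral_congr_fun hBm fun z hz => ?_
  rw [hD T z hz, mul_comm]

/-- If `w` is real valued and `|h| ≤ M w`, then the autocorrelation of `h` is dominated by `M ^ 2`
times that of `w`. -/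
lemma norm_correlation_le {h w : K → ℂ} {M : ℝ} (hw : Integrable w μ)
    (hw1 : ∀ x, ‖w x‖ ≤ 1) (hwr : ∀ x, ((w x).re : ℂ) = w x)
    (hhw : ∀ x, ‖h x‖ ≤ M * (w x).re) (z : K) :
    ((correlation μ w z).re : ℂ) = correlation μ w z ∧
      ‖correlation μ h z‖ ≤ M ^ 2 * (correlation μ w z).re := by
  have := secondCountable_of_locallyCompact K
  have hi : Integrable (fun x => (w (x + z)).re * (w x).re) μ := by
    refine hw.re.bdd_mul (c := 1) (hw.comp_add_right z).re.1 (.of_forall fun x => ?_)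
    exact (Complex.abs_re_le_norm _).trans (hw1 _)
  have hcor : correlation μ w z = ((∫ x, (w (x + z)).re * (w x).re ∂μ : ℝ) : ℂ) := by
    rw [← integral_complex_ofReal, correlation]
    congr 1; ext x
    rw [← hwr x, ← hwr (x + z), Complex.conj_ofReal]
    push_cast
    simp only [Complex.ofReal_re]
  refine ⟨by rw [hcor, Complex.ofReal_re], ?_⟩
  rw [hcor, Complex.ofReal_re, ← integral_const_mul]
  refine norm_integral_le_of_norm_le (hi.const_mul _) (.of_forall fun x => ?_)
  rw [norm_mul, RCLike.norm_conj]
  calc _ ≤ (M * (w (x + z)).re) * (M * (w x).re) :=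
        mul_le_mul (hhw _) (hhw _) (norm_nonneg _) ((norm_nonneg _).trans (hhw _))
    _ = _ := by ring

/-- If Bessel's inequality with bound `1` for the characters `χ(u(t) ·)` holds at the indicator
function of `W`, then Parseval's identity holds at all bounded functions which vanish outside of
`W`: the error terms off the diagonal for such a function are dominated by those for the
indicator function, which tend to `0`. -/
lemma tsum_enorm_sq_eq_of_bounded (H : IsNormalized ϖ μ) (hχ : Continuous χ)
    (hD0 : ∀ (T : ℕ) (z : K), ∃ r : ℝ, 0 ≤ r ∧
      ∑ t ∈ Finset.range (residueCard K ^ T), (χ (u t * z) : ℂ) = r)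
    (hD : ∀ (T : ℕ) (z : K), ‖z‖ ≤ (residueCard K : ℝ) ^ (-(T : ℤ)) →
      ∑ t ∈ Finset.range (residueCard K ^ T), (χ (u t * z) : ℂ) =
        (((residueCard K : ℝ) ^ (T : ℤ) : ℝ) : ℂ))
    {W : Set K} (hW : MeasurableSet W) (hWfin : μ W ≠ ∞)
    (hWB : ∑' t, ‖∫ x in W, (χ (u t * x) : ℂ) ∂μ‖ₑ ^ 2 ≤ μ W)
    {h : K → ℂ} (hh : AEStronglyMeasurable h μ) {M : ℝ} (hM : ∀ x, ‖h x‖ ≤ M)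
    (hh0 : ∀ x ∉ W, h x = 0) :
    ∑' t, ‖∫ x, h x * (χ (u t * x) : ℂ) ∂μ‖ₑ ^ 2 = ∫⁻ x, ‖h x‖ₑ ^ 2 ∂μ := by
  set w : K → ℂ := W.indicator fun _ => 1 with hw
  have hwm : ∀ r : ℝ≥0∞, MemLp w r μ := fun r => memLp_indicator_const r hW 1 (Or.inr hWfin)
  have hwi : Integrable w μ := memLp_one_iff_integrable.1 (hwm 1)
  have hM0 : 0 ≤ M := (norm_nonneg _).trans (hM 0)
  have hw_on : ∀ x ∈ W, w x = 1 := fun x hx => Set.indicator_of_mem hx _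
  have hw_off : ∀ x ∉ W, w x = 0 := fun x hx => Set.indicator_of_notMem hx _
  have hhw : ∀ x, ‖h x‖ ≤ M * (w x).re := fun x => by
    by_cases hx : x ∈ W
    · simpa [hw_on x hx] using hM x
    · simp [hw_off x hx, hh0 x hx]
  have hw1 : ∀ x, ‖w x‖ ≤ 1 := fun x => by
    by_cases hx : x ∈ W <;> simp [hw_on, hw_off, hx]
  have hwr : ∀ x, ((w x).re : ℂ) = w x := fun x => by
    by_cases hx : x ∈ W <;> simp [hw_on, hw_off, hx]
  have hhm : ∀ r : ℝ≥0∞, MemLp h r μ := fun r =>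
    (hwm r).of_le_mul (c := M) hh (.of_forall fun x => (hhw x).trans
      (mul_le_mul_of_nonneg_left ((le_abs_self _).trans (Complex.abs_re_le_norm _)) hM0))
  have hhi : Integrable h μ := memLp_one_iff_integrable.1 (hhm 1)
  have hq1 := H.one_lt_q
  set q := residueCard K with hqdef
  set D : ℕ → K → ℂ := fun T z => ∑ t ∈ Finset.range (q ^ T), (χ (u t * z) : ℂ) with hDdef
  set B : ℕ → Set K := fun T => {z : K | ‖z‖ ≤ (q : ℝ) ^ (-(T : ℤ))} with hBdef
  have hBm : ∀ T, MeasurableSet (B T) := fun T => measurableSet_norm_le _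
  -- `S` is the partial sum, `I` its main term on the ball `B`, and `R` the error term outside
  set S : (K → ℂ) → ℕ → ℝ := fun g T =>
    ∑ t ∈ Finset.range (q ^ T), ‖∫ x, g x * (χ (u t * x) : ℂ) ∂μ‖ ^ 2 with hS
  set I : (K → ℂ) → ℕ → ℂ := fun g T => ((q : ℝ) ^ (T : ℤ) : ℝ) * ∫ z in B T, correlation μ g z ∂μ
    with hI
  set R : (K → ℂ) → ℕ → ℂ := fun g T => ∫ z in (B T)ᶜ, correlation μ g z * D T z ∂μ with hR
  have hSIR : ∀ g, Integrable g μ → ∀ T, (S g T : ℂ) = I g T + R g T := fun g hg T =>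
    sum_norm_integral_sq_eq_add hχ hD hg T
  have hIw : Tendsto (I w) atTop (𝓝 (μ.real W : ℂ)) := by
    have h1 := H.tendsto_average_correlation hwi (hwm 2)
    have h2 : ∫ x, ‖w x‖ ^ 2 ∂μ = μ.real W := by
      rw [← integral_indicator_one hW]
      congr 1; ext x
      by_cases hx : x ∈ W <;> simp [hw_on, hw_off, hx]
    rwa [h2] at h1
  have hIh : Tendsto (I h) atTop (𝓝 ((∫ x, ‖h x‖ ^ 2 ∂μ : ℝ) : ℂ)) :=
    H.tendsto_average_correlation hhi (hhm 2)
  have hsum : ∀ g T, ∑ t ∈ Finset.range (q ^ T), ‖∫ x, g x * (χ (u t * x) : ℂ) ∂μ‖ₑ ^ 2 =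
      ENNReal.ofReal (S g T) := fun g T => by
    rw [hS, ENNReal.ofReal_sum_of_nonneg fun _ _ => by positivity]
    refine Finset.sum_congr rfl fun t _ => ?_
    rw [ENNReal.ofReal_pow (norm_nonneg _), ofReal_norm]
  have hSw : ∀ T, S w T ≤ μ.real W := fun T => by
    have h1 : ENNReal.ofReal (S w T) ≤ μ W := by
      rw [← hsum]
      refine (ENNReal.sum_le_tsum _).trans (le_trans (le_of_eq ?_) hWB)
      congr 1; ext t
      rw [← integral_indicator hW]
      congr 3; ext x
      by_cases hx : x ∈ W <;> simp [hw_on, hw_off, hx]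
    exact (ENNReal.ofReal_le_iff_le_toReal hWfin).1 h1
  have hRle : ∀ T, ‖R h T‖ ≤ M ^ 2 * (R w T).re := fun T => by
    have hint : Integrable (fun z => correlation μ w z * D T z) (μ.restrict (B T)ᶜ) :=
      (integrable_correlation_mul_sum hχ hwi _).integrableOn
    have hre : (R w T).re = ∫ z in (B T)ᶜ, (correlation μ w z * D T z).re ∂μ :=
      (integral_re hint).symm
    rw [hre, ← integral_const_mul]
    refine norm_integral_le_of_norm_le (hint.re.const_mul _) (.of_forall fun z => ?_)
    obtain ⟨r, hr0, hr⟩ := hD0 T z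
    obtain ⟨h1, h2⟩ := norm_correlation_le hwi hw1 hwr hhw z (μ := μ)
    have hr' : D T z = r := hr
    rw [hr', norm_mul, Complex.norm_real, Real.norm_of_nonneg hr0, Complex.re_mul_ofReal,
      ← mul_assoc]
    exact mul_le_mul_of_nonneg_right h2 hr0
  have hRw : ∀ T, (R w T).re ≤ μ.real W - (I w T).re := fun T => by
    have h1 := congrArg Complex.re (hSIR w hwi T)
    rw [Complex.ofReal_re, Complex.add_re] at h1
    have := hSw T
    linarith
  -- Bessel's inequality at `w` makes the error term of `w`, hence that of `h`, tend to `0`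
  have hRh : Tendsto (R h) atTop (𝓝 0) := by
    have h1 : Tendsto (fun T => M ^ 2 * (μ.real W - (I w T).re)) atTop (𝓝 0) := by
      have h2 := ((Complex.continuous_re.tendsto _).comp hIw).const_sub (μ.real W)
      have h3 := h2.const_mul (M ^ 2)
      rw [Complex.ofReal_re, sub_self, mul_zero] at h3
      exact h3
    exact squeeze_zero_norm (fun T => (hRle T).trans
      (mul_le_mul_of_nonneg_left (hRw T) (sq_nonneg M))) h1
  have hSh : Tendsto (S h) atTop (𝓝 (∫ x, ‖h x‖ ^ 2 ∂μ)) := by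
    have h1 := hIh.add hRh
    simp_rw [← hSIR h hhi, add_zero] at h1
    exact (Complex.continuous_re.tendsto _).comp h1
  rw [lintegral_enorm_sq_eq_ofReal (hhm 2)]
  refine tendsto_nhds_unique ?_ (ENNReal.tendsto_ofReal hSh)
  simp_rw [← hsum]
  exact (ENNReal.tendsto_nat_tsum _).comp (tendsto_pow_atTop_atTop_of_one_lt hq1)

end Parseval

/-! ### Extension of Parseval's identity by density -/

section Density

/-- Parseval's identity on a dense set implies Parseval's identity everywhere: by lower
semicontinuity Bessel's inequality extends first, and it makes the analysis operator continuous. -/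
lemma tsum_enorm_inner_sq_eq_of_dense {E : Type*} [NormedAddCommGroup E] [InnerProductSpace ℂ E]
    {e : ℕ → E} {D : Set E} (hD : Dense D)
    (hP : ∀ x ∈ D, ∑' t, ‖inner ℂ (e t) x‖ₑ ^ 2 = ‖x‖ₑ ^ 2) (x : E) :
    ∑' t, ‖inner ℂ (e t) x‖ₑ ^ 2 = ‖x‖ₑ ^ 2 := by
  have hBessel : ∀ x : E, ∑' t, ‖inner ℂ (e t) x‖ₑ ^ 2 ≤ ‖x‖ₑ ^ 2 := by
    intro x
    rw [ENNReal.tsum_eq_iSup_sum]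
    refine iSup_le fun s => ?_
    have hcl : IsClosed {x : E | ∑ t ∈ s, ‖inner ℂ (e t) x‖ₑ ^ 2 ≤ ‖x‖ₑ ^ 2} := by
      refine isClosed_le (continuous_finsetSum _ fun t _ => ?_) ?_
      · exact (ENNReal.continuous_pow 2).comp
          (continuous_enorm.comp (continuous_const.inner continuous_id))
      · exact (ENNReal.continuous_pow 2).comp continuous_enorm
    exact hcl.closure_subset_iff.2 (fun y hy => (ENNReal.sum_le_tsum _).trans (hP y hy).le) (hD x)
  set N : E → ℝ≥0∞ := fun y => eLpNorm (fun t => inner ℂ (e t) y) 2 Measure.count with hN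
  have hN2 : ∀ y, N y ^ 2 = ∑' t, ‖inner ℂ (e t) y‖ₑ ^ 2 := fun y => by
    rw [hN, eLpNorm_two_sq, lintegral_count]
  have hmono := (ENNReal.pow_right_strictMono (n := 2) two_ne_zero)
  have hNle : ∀ y, N y ≤ ‖y‖ₑ := fun y => hmono.le_iff_le.1 ((hN2 y).trans_le (hBessel y))
  have hNadd : ∀ y z, N (y + z) ≤ N y + N z := fun y z => by
    have : (fun t => inner ℂ (e t) (y + z)) =
        (fun t => inner ℂ (e t) y) + fun t => inner ℂ (e t) z := by
      ext t; simp
    simp only [hN, this]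
    exact eLpNorm_add_le (by fun_prop) (by fun_prop) (by simp)
  refine le_antisymm (hBessel x) ?_
  rw [← hN2]
  refine hmono.monotone (ENNReal.le_of_forall_pos_le_add fun δ hδ _ => ?_)
  obtain ⟨y, hy, hxy⟩ := EMetric.mem_closure_iff.1 (hD x) (δ / 2 : ℝ≥0)
    (by exact_mod_cast half_pos hδ)
  rw [edist_eq_enorm_sub] at hxy
  have hNy : N y = ‖y‖ₑ := hmono.injective ((hN2 y).trans (hP y hy))
  have h1 : ‖y - x‖ₑ = ‖x - y‖ₑ := enorm_sub_rev y x
  calc ‖x‖ₑ = ‖y + (x - y)‖ₑ := by rw [add_sub_cancel]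
    _ ≤ ‖y‖ₑ + ‖x - y‖ₑ := enorm_add_le _ _
    _ = N (x + (y - x)) + ‖x - y‖ₑ := by rw [add_sub_cancel, hNy]
    _ ≤ N x + ‖y - x‖ₑ + ‖x - y‖ₑ := by gcongr; exact (hNadd _ _).trans (by gcongr; exact hNle _)
    _ ≤ N x + (δ / 2 : ℝ≥0) + (δ / 2 : ℝ≥0) := by rw [h1]; gcongr
    _ = N x + δ := by rw [add_assoc, ← ENNReal.coe_add, add_halves]

variable {K : Type*} [NontriviallyNormedField K] [IsUltrametricDist K] [MeasurableSpace K]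
  [BorelSpace K] [LocallyCompactSpace K] {ϖ : K} {μ : Measure K} [μ.IsAddHaarMeasure]
  {χ : AddChar K Circle} {u : ℕ → K}

/-- Parseval's identity on `L²(W)` for the characters `χ(u(t) ·)`, under Bessel's inequality at the
indicator function of `W`. -/
lemma tsum_enorm_sq_setIntegral_eq (H : IsNormalized ϖ μ) (hχ : Continuous χ)
    (hD0 : ∀ (T : ℕ) (z : K), ∃ r : ℝ, 0 ≤ r ∧
      ∑ t ∈ Finset.range (residueCard K ^ T), (χ (u t * z) : ℂ) = r)
    (hD : ∀ (T : ℕ) (z : K), ‖z‖ ≤ (residueCard K : ℝ) ^ (-(T : ℤ)) →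
      ∑ t ∈ Finset.range (residueCard K ^ T), (χ (u t * z) : ℂ) =
        (((residueCard K : ℝ) ^ (T : ℤ) : ℝ) : ℂ))
    {W : Set K} (hW : NullMeasurableSet W μ) (hWfin : μ W ≠ ∞)
    (hWB : ∑' t, ‖∫ x in W, (χ (u t * x) : ℂ) ∂μ‖ₑ ^ 2 ≤ μ W)
    {h : K → ℂ} (hh : MemLp h 2 μ) :
    ∑' t, ‖∫ x in W, h x * (χ (u t * x) : ℂ) ∂μ‖ₑ ^ 2 = ∫⁻ x in W, ‖h x‖ₑ ^ 2 ∂μ := by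
  obtain ⟨V, hVm, hVW⟩ : ∃ V, MeasurableSet V ∧ W =ᵐ[μ] V :=
    ⟨toMeasurable μ W, measurableSet_toMeasurable _ _, hW.toMeasurable_ae_eq.symm⟩
  rw [Measure.restrict_congr_set hVW] at hWB ⊢
  rw [measure_congr hVW] at hWB hWfin
  have := secondCountable_of_locallyCompact K
  set ν := μ.restrict V with hν
  have hfin : IsFiniteMeasure ν := ⟨by
    rw [hν, Measure.restrict_apply_univ]; exact hWfin.lt_top⟩
  have hcont : ∀ t, Continuous fun x => (χ (u t * x) : ℂ) := fun t =>
    (continuous_circle_coe hχ).comp (g := fun w => (χ w : ℂ)) (f := fun x => u t * x) (by fun_prop)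
  have he : ∀ t, MemLp (fun x => (starRingEnd ℂ) (χ (u t * x) : ℂ)) 2 ν := fun t =>
    MemLp.of_bound (Complex.continuous_conj.comp (hcont t)).aestronglyMeasurable 1
      (.of_forall fun x => by rw [RCLike.norm_conj]; exact (Circle.norm_coe _).le)
  have hinner : ∀ (g : K → ℂ) (hg : MemLp g 2 ν) (t : ℕ),
      inner ℂ ((he t).toLp _) (hg.toLp g) = ∫ x, g x * (χ (u t * x) : ℂ) ∂ν := by
    intro g hg t
    rw [L2.inner_def]
    refine integral_congr_ae ?_
    filter_upwards [hg.coeFn_toLp, (he t).coeFn_toLp] with x hx hx'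
    rw [hx, hx', RCLike.inner_apply, Complex.conj_conj]
  have hnorm : ∀ (g : K → ℂ) (hg : MemLp g 2 ν), ‖hg.toLp g‖ₑ ^ 2 = ∫⁻ x, ‖g x‖ₑ ^ 2 ∂ν := by
    intro g hg
    rw [Lp.enorm_toLp, eLpNorm_two_sq]
  have hhν : MemLp h 2 ν := hh.restrict V
  have key := tsum_enorm_inner_sq_eq_of_dense (e := fun t => (he t).toLp _)
    (D := (Lp.simpleFunc ℂ 2 ν : Set (Lp ℂ 2 ν))) (Lp.simpleFunc.dense (by simp)) ?_
    (hhν.toLp h)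
  · simp_rw [hinner, hnorm] at key
    exact key
  · intro f hf
    set s := Lp.simpleFunc.toSimpleFunc ⟨f, hf⟩ with hs
    have hsm : MemLp s 2 ν := Lp.simpleFunc.memLp ⟨f, hf⟩
    have hfs : f = hsm.toLp s := by
      refine Lp.ext ((Lp.simpleFunc.toSimpleFunc_eq_toFun ⟨f, hf⟩).symm.trans
        hsm.coeFn_toLp.symm)
    rw [hfs]
    simp_rw [hinner, hnorm]
    obtain ⟨M, hM⟩ := s.exists_forall_norm_le
    have hb := tsum_enorm_sq_eq_of_bounded H hχ hD0 hD hVm hWfin hWB (h := V.indicator s)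
      ((s.stronglyMeasurable.indicator hVm).aestronglyMeasurable) (M := M)
      (fun x => (norm_indicator_le_norm_self _ _).trans (hM x))
      (fun x hx => Set.indicator_of_notMem hx _)
    rw [hν, ← lintegral_indicator hVm]
    simp_rw [← integral_indicator hVm]
    have h1 : ∀ t, V.indicator (fun x => s x * (χ (u t * x) : ℂ)) =
        fun x => V.indicator s x * (χ (u t * x) : ℂ) := fun t => by
      ext x
      by_cases hx : x ∈ V <;> simp [hx]
    have h2 : V.indicator (fun x => ‖s x‖ₑ ^ 2) = fun x => ‖V.indicator s x‖ₑ ^ 2 := by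
      ext x
      by_cases hx : x ∈ V <;> simp [hx]
    simp_rw [h1, h2]
    exact hb

end Density

/-! ### Dilates -/

section Dilates

variable {K : Type*} [NontriviallyNormedField K] [IsUltrametricDist K] [MeasurableSpace K]
  [BorelSpace K] {ϖ : K} {μ : Measure K} {χ : AddChar K Circle} {u : ℕ → K}

lemma IsNormalized.smul_eq_preimage (H : IsNormalized ϖ μ) (j : ℤ) (s : Set K) :
    ϖ ^ (-j) • s = (fun x => ϖ ^ j * x) ⁻¹' s := by
  ext x
  rw [Set.mem_smul_set_iff_inv_smul_mem₀ (zpow_ne_zero _ H.prime.ne_zero), zpow_neg, inv_inv]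
  rfl

lemma IsNormalized.smul_iUnion_dilates (H : IsNormalized ϖ μ) {L : ℕ} (W : Fin L → Set K) (k : ℤ) :
    ϖ ^ k • (⋃ i : ℤ × Fin L, ϖ ^ i.1 • W i.2) = ⋃ i : ℤ × Fin L, ϖ ^ i.1 • W i.2 := by
  have h0 := H.prime.ne_zero
  simp_rw [Set.smul_set_iUnion, smul_smul, ← zpow_add₀ h0]
  exact ((Equiv.addLeft k).prodCongr (Equiv.refl (Fin L))).surjective.iUnion_comp
    (fun i : ℤ × Fin L => ϖ ^ i.1 • W i.2)

variable [LocallyCompactSpace K] [μ.IsAddHaarMeasure]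

lemma IsNormalized.nullMeasurableSet_smul (H : IsNormalized ϖ μ) (j : ℤ) {s : Set K}
    (hs : NullMeasurableSet s μ) : NullMeasurableSet (ϖ ^ j • s) μ := by
  rw [← neg_neg j, H.smul_eq_preimage]
  exact hs.preimage (H.quasiMeasurePreserving_mul _)

lemma IsNormalized.enorm_rpow (H : IsNormalized ϖ μ) (s : ℝ) :
    ‖(((residueCard K : ℝ) ^ s : ℝ) : ℂ)‖ₑ = (residueCard K : ℝ≥0∞) ^ s := by
  rw [← ofReal_norm, Complex.norm_real, Real.norm_of_nonneg (Real.rpow_nonneg H.q_pos.le s),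
    ← ENNReal.ofReal_rpow_of_pos H.q_pos, ENNReal.ofReal_natCast]

/-- Parseval's identity on `W` passes to the dilates of `W`. -/
lemma tsum_enorm_sq_dilate (H : IsNormalized ϖ μ) {W : Set K} (hW : NullMeasurableSet W μ)
    (hP : ∀ h : K → ℂ, MemLp h 2 μ →
      ∑' t, ‖∫ x in W, h x * (χ (u t * x) : ℂ) ∂μ‖ₑ ^ 2 = ∫⁻ x in W, ‖h x‖ₑ ^ 2 ∂μ)
    {h : K → ℂ} (hh : MemLp h 2 μ) (j : ℤ) :
    ∑' t, (residueCard K : ℝ≥0∞) ^ (-j) *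
        ‖∫ ξ in ϖ ^ (-j) • W, h ξ * (χ (u t * (ϖ ^ j * ξ)) : ℂ) ∂μ‖ₑ ^ 2 =
      ∫⁻ ξ in ϖ ^ (-j) • W, ‖h ξ‖ₑ ^ 2 ∂μ := by
  have h0 := H.prime.ne_zero
  have hinv : ∀ ξ : K, ϖ ^ (-j) * (ϖ ^ j * ξ) = ξ := fun ξ => by
    rw [← mul_assoc, ← zpow_add₀ h0, neg_add_cancel, zpow_zero, one_mul]
  have hWj := H.nullMeasurableSet_smul (-j) hW
  have hq : (residueCard K : ℝ≥0∞) ^ (-j) * (((residueCard K : ℝ≥0∞) ^ j) ^ 2) =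
      (residueCard K : ℝ≥0∞) ^ j := by
    rw [pow_two, ← mul_assoc, ← ENNReal.zpow_add H.q_ne_zero (by simp), neg_add_cancel, zpow_zero,
      one_mul]
  have h1 : ∀ t, ∫ ξ in ϖ ^ (-j) • W, h ξ * (χ (u t * (ϖ ^ j * ξ)) : ℂ) ∂μ =
      (((residueCard K : ℝ) ^ (j : ℝ) : ℝ) : ℂ) *
        ∫ x in W, h (ϖ ^ (-j) * x) * (χ (u t * x) : ℂ) ∂μ := by
    intro t
    rw [← integral_indicator₀ hWj, ← integral_indicator₀ hW, Real.rpow_intCast,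
      ← H.integral_comp_mul j]
    congr 1; ext ξ
    rw [H.smul_eq_preimage]
    by_cases hξ : ϖ ^ j * ξ ∈ W
    · rw [Set.indicator_of_mem (by exact hξ), Set.indicator_of_mem hξ, hinv]
    · rw [Set.indicator_of_notMem (by exact hξ), Set.indicator_of_notMem hξ]
  have h2 : MemLp (fun x => h (ϖ ^ (-j) * x)) 2 μ := by
    simpa using H.memLp_comp_mul_sub (-j) 0 hh
  have h3 : ∀ t, (residueCard K : ℝ≥0∞) ^ (-j) *
        ‖∫ ξ in ϖ ^ (-j) • W, h ξ * (χ (u t * (ϖ ^ j * ξ)) : ℂ) ∂μ‖ₑ ^ 2 =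
      (residueCard K : ℝ≥0∞) ^ j *
        ‖∫ x in W, h (ϖ ^ (-j) * x) * (χ (u t * x) : ℂ) ∂μ‖ₑ ^ 2 := fun t => by
    rw [h1, enorm_mul, H.enorm_rpow, ENNReal.rpow_intCast, mul_pow, ← mul_assoc, hq]
  rw [tsum_congr h3, ENNReal.tsum_mul_left, hP _ h2, ← lintegral_indicator₀ hWj,
    ← lintegral_indicator₀ hW, ← H.lintegral_comp_mul j]
  congr 1; ext ξ
  rw [H.smul_eq_preimage]
  by_cases hξ : ϖ ^ j * ξ ∈ W
  · rw [Set.indicator_of_mem hξ, Set.indicator_of_mem (by exact hξ), hinv]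
  · rw [Set.indicator_of_notMem hξ, Set.indicator_of_notMem (by exact hξ)]

/-- The coefficients of the affine system generated by a function with Fourier transform `1_W`. -/
lemma enorm_integral_mul_conj_affine_sq (H : IsNormalized ϖ μ) (hχ : IsBasicCharacter ϖ χ)
    {W : Set K} (hW : NullMeasurableSet W μ) {f g ψ : K → ℂ} (hf : IsFourierTransform χ μ f g)
    (hψ : IsFourierTransform χ μ ψ (W.indicator fun _ => 1)) (j : ℤ) (t : ℕ) :
    ‖∫ x, f x * (starRingEnd ℂ) (affine ϖ u ψ j t x) ∂μ‖ₑ ^ 2 =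
      (residueCard K : ℝ≥0∞) ^ (-j) *
        ‖∫ ξ in ϖ ^ (-j) • W, g ξ * (χ (u t * (ϖ ^ j * ξ)) : ℂ) ∂μ‖ₑ ^ 2 := by
  rw [hf.integral_mul_conj H hχ (hψ.affine H hχ u j t)]
  have h1 : ∀ ξ, g ξ * (starRingEnd ℂ) ((((residueCard K : ℝ) ^ (-(j : ℝ) / 2) : ℝ) : ℂ) *
      (χ (-(u t * (ϖ ^ j * ξ))) : ℂ) * W.indicator (fun _ => 1) (ϖ ^ j * ξ)) =
      (((residueCard K : ℝ) ^ (-(j : ℝ) / 2) : ℝ) : ℂ) * (ϖ ^ (-j) • W).indicator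
        (fun ξ => g ξ * (χ (u t * (ϖ ^ j * ξ)) : ℂ)) ξ := fun ξ => by
    rw [H.smul_eq_preimage]
    by_cases hξ : ϖ ^ j * ξ ∈ W
    · rw [Set.indicator_of_mem hξ, Set.indicator_of_mem (by exact hξ), mul_one, map_mul,
        Complex.conj_ofReal, AddChar.map_neg_eq_inv, Circle.coe_inv_eq_conj, Complex.conj_conj]
      ring
    · rw [Set.indicator_of_notMem hξ, Set.indicator_of_notMem (by exact hξ)]
      simp
  simp_rw [h1]
  rw [integral_const_mul, integral_indicator₀ (H.nullMeasurableSet_smul _ hW), enorm_mul, mul_pow,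
    H.enorm_rpow, ← ENNReal.rpow_natCast, ← ENNReal.rpow_mul, ← ENNReal.rpow_intCast]
  congr 2
  push_cast; ring

/-- The annulus `{|ξ| = 1}` has measure `1 - 1 / q`. -/
lemma IsNormalized.measure_norm_eq_one (H : IsNormalized ϖ μ) :
    μ {x : K | ‖x‖ = 1} = ENNReal.ofReal (((residueCard K : ℝ) - 1) / residueCard K) := by
  have hA : {x : K | ‖x‖ = 1} =
      {x : K | ‖x‖ ≤ 1} \ {x : K | ‖x‖ ≤ (residueCard K : ℝ) ^ (-1 : ℤ)} := by
    ext x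
    rw [zpow_neg_one, ← H.norm_eq]
    simp only [Set.mem_ofPred_eq, Set.mem_sdiff, not_le]
    constructor
    · intro h
      exact ⟨h.le, h ▸ H.prime.1⟩
    · rintro ⟨h1, h2⟩
      by_contra hne
      exact absurd (H.prime.2 x (lt_of_le_of_ne h1 hne)) (not_le.2 h2)
  have hsub : {x : K | ‖x‖ ≤ (residueCard K : ℝ) ^ (-1 : ℤ)} ⊆ {x : K | ‖x‖ ≤ 1} := by
    intro x hx
    rw [zpow_neg_one, ← H.norm_eq] at hx
    exact le_trans hx H.prime.1.le
  rw [hA, measure_sdiff hsub (measurableSet_norm_le _).nullMeasurableSet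
    (H.measure_norm_le_lt_top _).ne, H.measure_eq, H.measure_norm_le, sub_div,
    div_self H.q_pos.ne', ENNReal.ofReal_sub _ (by positivity), ENNReal.ofReal_one, one_div,
    ENNReal.ofReal_inv_of_pos H.q_pos, ENNReal.ofReal_natCast, ENNReal.zpow_neg, zpow_one]

lemma IsNormalized.iUnion_smul_annulus (H : IsNormalized ϖ μ) :
    ⋃ j : ℤ, ϖ ^ j • {x : K | ‖x‖ = 1} = {0}ᶜ := by
  ext x
  simp only [Set.mem_iUnion, Set.mem_compl_iff, Set.mem_singleton_iff,
    Set.mem_smul_set_iff_inv_smul_mem₀ (zpow_ne_zero _ H.prime.ne_zero), Set.mem_ofPred_eq,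
    smul_eq_mul, norm_mul, norm_inv, _root_.norm_zpow]
  have h0 : 0 < ‖ϖ‖ := norm_pos_iff.2 H.prime.ne_zero
  constructor
  · rintro ⟨j, hj⟩ rfl
    simp at hj
  · intro hx
    obtain ⟨j, hj⟩ := H.prime.exists_norm_eq_zpow hx
    exact ⟨j, by rw [hj, inv_mul_cancel₀ (zpow_pos h0 j).ne']⟩

/-- By invariance under dilations, a union of dilates is conull as soon as it fills the annulus
`{|ξ| = 1}`. -/
lemma IsNormalized.measure_compl_dilates_eq_zero_iff (H : IsNormalized ϖ μ) {L : ℕ}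
    {W : Fin L → Set K} (hW : ∀ m, NullMeasurableSet (W m) μ) :
    μ (⋃ i : ℤ × Fin L, ϖ ^ i.1 • W i.2)ᶜ = 0 ↔
      μ ((⋃ i : ℤ × Fin L, ϖ ^ i.1 • W i.2) ∩ {x : K | ‖x‖ = 1}) = μ {x : K | ‖x‖ = 1} := by
  set U := ⋃ i : ℤ × Fin L, ϖ ^ i.1 • W i.2 with hU
  set A := {x : K | ‖x‖ = 1} with hA
  have := secondCountable_of_locallyCompact K
  have hUm : NullMeasurableSet U μ :=
    NullMeasurableSet.iUnion fun i => H.nullMeasurableSet_smul _ (hW _)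
  have hAU := measure_inter_add_sdiff₀ (μ := μ) A hUm
  have hAfin : μ A ≠ ∞ := by rw [H.measure_norm_eq_one]; exact ENNReal.ofReal_ne_top
  have hfin : μ (A ∩ U) ≠ ∞ := measure_ne_top_of_subset Set.inter_subset_left hAfin
  have h1 : μ (U ∩ A) = μ A ↔ μ (A \ U) = 0 := by
    rw [Set.inter_comm]
    constructor
    · intro h
      rw [h] at hAU hfin
      exact (ENNReal.add_right_inj hfin).1 (hAU.trans (add_zero _).symm)
    · intro h
      rwa [h, add_zero] at hAU
  rw [h1]
  refine ⟨fun h => measure_mono_null (fun x hx => hx.2) h, fun h => ?_⟩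
  have hsub : Uᶜ ⊆ {0} ∪ ⋃ j : ℤ, ϖ ^ j • (A \ U) := by
    intro x hx
    by_cases hx0 : x = 0
    · exact Or.inl hx0
    · right
      have hx' : x ∈ ⋃ j : ℤ, ϖ ^ j • A := by rw [H.iUnion_smul_annulus]; exact hx0
      obtain ⟨j, hj⟩ := Set.mem_iUnion.1 hx'
      refine Set.mem_iUnion.2 ⟨j, ?_⟩
      rw [Set.smul_set_sdiff₀ (zpow_ne_zero _ H.prime.ne_zero), H.smul_iUnion_dilates]
      exact ⟨hj, hx⟩
  refine measure_mono_null hsub (measure_union_null (measure_singleton 0)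
    (measure_iUnion_null fun j => ?_))
  rw [H.measure_smul, h, mul_zero]

/-- If the dilates of the sets `W m` are disjoint, then folding the multiplicative Haar measure
`dξ / |ξ|` into the annulus `{|ξ| = 1}` measures the part of the annulus covered by the dilates. -/
lemma IsNormalized.lintegral_inv_norm_eq (H : IsNormalized ϖ μ) {L : ℕ} {W : Fin L → Set K}
    (hW : ∀ m, NullMeasurableSet (W m) μ)
    (hdisj : Pairwise fun i k : ℤ × Fin L => AEDisjoint μ (ϖ ^ i.1 • W i.2) (ϖ ^ k.1 • W k.2)) :
    ∫⁻ ξ in ⋃ m, W m, ‖ξ‖ₑ⁻¹ ∂μ =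
      μ ((⋃ i : ℤ × Fin L, ϖ ^ i.1 • W i.2) ∩ {x : K | ‖x‖ = 1}) := by
  have := secondCountable_of_locallyCompact K
  have h0 := H.prime.ne_zero
  set V := ⋃ m, W m with hV
  set A := {x : K | ‖x‖ = 1} with hA
  have hAm : MeasurableSet A := (isClosed_eq continuous_norm continuous_const).measurableSet
  have hVm : NullMeasurableSet V μ := NullMeasurableSet.iUnion hW
  have hpm : ∀ j : ℤ, NullMeasurableSet (V ∩ ϖ ^ j • A) μ := fun j =>
    hVm.inter (H.nullMeasurableSet_smul j hAm.nullMeasurableSet)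
  have hnorm : ∀ (j : ℤ) (x : K), x ∈ ϖ ^ j • A → ‖x‖ = ‖ϖ‖ ^ j := fun j x hx => by
    obtain ⟨y, hy, rfl⟩ := hx
    have hy' : ‖y‖ = 1 := hy
    simp only [smul_eq_mul, norm_mul, _root_.norm_zpow, hy', mul_one]
  have hpd : Pairwise fun i j : ℤ => AEDisjoint μ (V ∩ ϖ ^ i • A) (V ∩ ϖ ^ j • A) := by
    intro i j hij
    refine (Set.disjoint_left.2 fun x hx hx' => hij ?_).aedisjoint
    have := (hnorm i x hx.2).symm.trans (hnorm j x hx'.2)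
    exact zpow_right_injective₀ (norm_pos_iff.2 h0) H.prime.1.ne this
  have hVA : V =ᵐ[μ] ⋃ j : ℤ, V ∩ ϖ ^ j • A := by
    rw [← Set.inter_iUnion, H.iUnion_smul_annulus]
    have : ({0}ᶜ : Set K) =ᵐ[μ] Set.univ := by
      rw [eventuallyEq_univ, mem_ae_iff, compl_compl]
      exact measure_singleton 0
    simpa using (ae_eq_set_inter (ae_eq_refl V) this).symm
  rw [Measure.restrict_congr_set hVA, lintegral_iUnion₀ hpm hpd]
  -- on each annulus the density is constant
  have h1 : ∀ j : ℤ, ∫⁻ ξ in V ∩ ϖ ^ j • A, ‖ξ‖ₑ⁻¹ ∂μ = μ (ϖ ^ (-j) • V ∩ A) := by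
    intro j
    have hc : ∀ x ∈ ϖ ^ j • A, ‖x‖ₑ⁻¹ = (residueCard K : ℝ≥0∞) ^ j := fun x hx => by
      rw [← ofReal_norm, hnorm j x hx, H.norm_eq, inv_zpow,
        ENNReal.ofReal_inv_of_pos (zpow_pos H.q_pos _), inv_inv, ← Real.rpow_intCast,
        ← ENNReal.ofReal_rpow_of_pos H.q_pos, ENNReal.ofReal_natCast, ENNReal.rpow_intCast]
    have hae : ∀ᵐ x ∂μ.restrict (V ∩ ϖ ^ j • A), ‖x‖ₑ⁻¹ = (residueCard K : ℝ≥0∞) ^ j := by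
      filter_upwards [ae_restrict_mem₀ (hpm j)] with x hx
      exact hc x hx.2
    rw [lintegral_congr_ae hae, setLIntegral_const]
    have h2 : ϖ ^ (-j) • V ∩ A = ϖ ^ (-j) • (V ∩ ϖ ^ j • A) := by
      rw [Set.smul_set_inter₀ (zpow_ne_zero _ h0), smul_smul, ← zpow_add₀ h0, neg_add_cancel,
        zpow_zero, one_smul]
    rw [h2, H.measure_smul, neg_neg]
  simp_rw [h1]
  have h3 : (⋃ i : ℤ × Fin L, ϖ ^ i.1 • W i.2) ∩ A = ⋃ j : ℤ, ϖ ^ (-j) • V ∩ A := by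
    rw [← Set.iUnion_inter, Set.iUnion_prod']
    congr 1
    rw [← (Equiv.neg ℤ).surjective.iUnion_comp]
    simp only [Equiv.neg_apply, hV, Set.smul_set_iUnion]
  rw [h3, measure_iUnion₀]
  · intro i j hij
    refine AEDisjoint.mono ?_ Set.inter_subset_left Set.inter_subset_left
    simp only [hV, Set.smul_set_iUnion]
    rw [AEDisjoint.iUnion_left_iff]
    intro m
    rw [AEDisjoint.iUnion_right_iff]
    intro n
    exact hdisj (i := (-i, m)) (j := (-j, n)) fun h => hij (neg_injective (congrArg Prod.fst h))
  · exact fun j => (H.nullMeasurableSet_smul _ hVm).inter hAm.nullMeasurableSet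

end Dilates

/-! ### Consequences of the Bessel bound -/

section Bessel

variable {K : Type*} [NontriviallyNormedField K] [IsUltrametricDist K] [LocallyCompactSpace K]
  [MeasurableSpace K] [BorelSpace K] {ϖ : K} {μ : Measure K} [μ.IsAddHaarMeasure]
  {χ : AddChar K Circle} {u : ℕ → K} {L : ℕ} {ψ : Fin L → K → ℂ} {W : Fin L → Set K}

lemma lintegral_enorm_indicator_one_sq {X : Type*} [MeasurableSpace X] {μ ν : Measure X}
    {s : Set X} (hs : NullMeasurableSet s μ) (hν : ν ≪ μ) :
    ∫⁻ x, ‖s.indicator (fun _ => (1 : ℂ)) x‖ₑ ^ 2 ∂ν = ν s := by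
  rw [← lintegral_indicator_one₀ (hs.mono_ac hν)]
  congr 1; ext x
  by_cases hx : x ∈ s <;> simp [hx]

lemma IsFourierTransform.measure_ne_top {f : K → ℂ} {s : Set K} (hs : NullMeasurableSet s μ)
    (h : IsFourierTransform χ μ f (s.indicator fun _ => 1)) : μ s ≠ ∞ := by
  rw [← lintegral_enorm_indicator_one_sq hs .rfl, ← eLpNorm_two_sq]
  exact ENNReal.pow_ne_top h.2.1.2.ne

lemma IsFourierTransform.eLpNorm_sq_eq_measure (H : IsNormalized ϖ μ) (hχ : IsBasicCharacter ϖ χ)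
    {f : K → ℂ} {s : Set K} (hs : NullMeasurableSet s μ)
    (h : IsFourierTransform χ μ f (s.indicator fun _ => 1)) : eLpNorm f 2 μ ^ 2 = μ s := by
  rw [← h.eLpNorm_eq H hχ, eLpNorm_two_sq, lintegral_enorm_indicator_one_sq hs .rfl]

/-- The Bessel bound, tested at `ψ m` itself, is Bessel's inequality at the indicator function of
`W m`. -/
lemma tsum_enorm_setIntegral_addChar_le (H : IsNormalized ϖ μ) (hχ : IsBasicCharacter ϖ χ)
    (hW : ∀ m, NullMeasurableSet (W m) μ)
    (hψ : ∀ m, IsFourierTransform χ μ (ψ m) ((W m).indicator fun _ => 1))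
    (hB : IsBesselet μ ϖ u ψ 1) (m : Fin L) :
    ∑' t, ‖∫ x in W m, (χ (u t * x) : ℂ) ∂μ‖ₑ ^ 2 ≤ μ (W m) := by
  have h1 := hB (ψ m) (hψ m).1
  rw [ENNReal.coe_one, one_mul, (hψ m).eLpNorm_sq_eq_measure H hχ (hW m)] at h1
  refine le_trans (le_trans ?_ (ENNReal.le_tsum m)) h1
  refine le_trans (le_of_eq ?_) (ENNReal.le_tsum (0 : ℤ))
  refine tsum_congr fun t => ?_
  rw [enorm_integral_mul_conj_affine_sq H hχ (hW m) (hψ m) (hψ m)]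
  simp only [neg_zero, zpow_zero, one_smul, one_mul]
  congr 2
  refine integral_congr_ae ?_
  filter_upwards [ae_restrict_mem₀ (hW m)] with x hx
  rw [Set.indicator_of_mem hx, one_mul]

/-- The Bessel bound, tested at `ψ n`, leaves no room for an overlap of `W n` with another
dilate. -/
lemma pairwise_aedisjoint_dilates (H : IsNormalized ϖ μ) (hχ : IsBasicCharacter ϖ χ)
    (hW : ∀ m, NullMeasurableSet (W m) μ)
    (hψ : ∀ m, IsFourierTransform χ μ (ψ m) ((W m).indicator fun _ => 1))
    (hB : IsBesselet μ ϖ u ψ 1)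
    (hP : ∀ m, ∀ h : K → ℂ, MemLp h 2 μ →
      ∑' t, ‖∫ x in W m, h x * (χ (u t * x) : ℂ) ∂μ‖ₑ ^ 2 = ∫⁻ x in W m, ‖h x‖ₑ ^ 2 ∂μ) :
    Pairwise fun i k : ℤ × Fin L => AEDisjoint μ (ϖ ^ i.1 • W i.2) (ϖ ^ k.1 • W k.2) := by
  have h0 := H.prime.ne_zero
  have h1 : ∀ n : Fin L, ∑' i : Fin L × ℤ, μ (W n ∩ ϖ ^ (-i.2) • W i.1) ≤ μ (W n) := by
    intro n
    have h2 := hB (ψ n) (hψ n).1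
    rw [ENNReal.coe_one, one_mul, (hψ n).eLpNorm_sq_eq_measure H hχ (hW n)] at h2
    rw [ENNReal.tsum_prod' (f := fun i : Fin L × ℤ => μ (W n ∩ ϖ ^ (-i.2) • W i.1))]
    refine le_trans (le_of_eq ?_) h2
    refine tsum_congr fun m => tsum_congr fun j => ?_
    rw [tsum_congr fun t => enorm_integral_mul_conj_affine_sq H hχ (hW m) (hψ n) (hψ m) j t,
      tsum_enorm_sq_dilate H (hW m) (hP m) (hψ n).2.1,
      lintegral_enorm_indicator_one_sq (hW n) Measure.restrict_le_self.absolutelyContinuous,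
      Measure.restrict_apply₀' (H.nullMeasurableSet_smul _ (hW m))]
  rintro ⟨j, m⟩ ⟨k, n⟩ hne
  have hne' : ((n, (0 : ℤ)) : Fin L × ℤ) ≠ (m, k - j) := fun h => by
    simp only [Prod.mk.injEq] at h
    exact hne (by rw [h.1, show j = k by omega])
  have h3 := (ENNReal.sum_le_tsum {((n, (0 : ℤ)) : Fin L × ℤ), (m, k - j)}).trans (h1 n)
  rw [Finset.sum_pair hne', neg_zero, zpow_zero, one_smul, Set.inter_self, neg_sub] at h3
  have h4 : μ (W n ∩ ϖ ^ (j - k) • W m) = 0 := by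
    have h5 := (hψ n).measure_ne_top (hW n)
    refine le_antisymm ?_ zero_le
    refine (ENNReal.add_le_add_iff_left h5).1 ?_
    rwa [add_zero]
  have h5 : ϖ ^ j • W m ∩ ϖ ^ k • W n = ϖ ^ k • (W n ∩ ϖ ^ (j - k) • W m) := by
    rw [Set.smul_set_inter₀ (zpow_ne_zero _ h0), smul_smul, ← zpow_add₀ h0, add_sub_cancel,
      Set.inter_comm]
  rw [AEDisjoint, h5, H.measure_smul, h4, mul_zero]

/-- If the dilates are disjoint, the energy of all affine coefficients is the energy of the Fourier
transform on the union of the dilates. -/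
lemma tsum_coefficients_eq (H : IsNormalized ϖ μ) (hW : ∀ m, NullMeasurableSet (W m) μ)
    (hP : ∀ m, ∀ h : K → ℂ, MemLp h 2 μ →
      ∑' t, ‖∫ x in W m, h x * (χ (u t * x) : ℂ) ∂μ‖ₑ ^ 2 = ∫⁻ x in W m, ‖h x‖ₑ ^ 2 ∂μ)
    (hdisj : Pairwise fun i k : ℤ × Fin L => AEDisjoint μ (ϖ ^ i.1 • W i.2) (ϖ ^ k.1 • W k.2))
    {h : K → ℂ} (hh : MemLp h 2 μ) :
    ∑' (m : Fin L) (j : ℤ) (t : ℕ), (residueCard K : ℝ≥0∞) ^ (-j) *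
        ‖∫ ξ in ϖ ^ (-j) • W m, h ξ * (χ (u t * (ϖ ^ j * ξ)) : ℂ) ∂μ‖ₑ ^ 2 =
      ∫⁻ ξ in ⋃ i : ℤ × Fin L, ϖ ^ i.1 • W i.2, ‖h ξ‖ₑ ^ 2 ∂μ := by
  rw [lintegral_iUnion₀ (fun i => H.nullMeasurableSet_smul _ (hW _)) hdisj,
    ENNReal.tsum_prod' (f := fun i : ℤ × Fin L => ∫⁻ ξ in ϖ ^ i.1 • W i.2, ‖h ξ‖ₑ ^ 2 ∂μ)]
  refine ENNReal.tsum_comm.trans (Eq.trans ?_ ((Equiv.neg ℤ).tsum_eq _))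
  exact tsum_congr fun j => tsum_congr fun m => tsum_enorm_sq_dilate H (hW m) (hP m) hh j

/-- If a set carries the energy of all Fourier transforms, it is conull: test on balls. -/
lemma measure_compl_eq_zero_of_forall_lintegral_eq (H : IsNormalized ϖ μ)
    (hχ : IsBasicCharacter ϖ χ) {U : Set K} (hU : NullMeasurableSet U μ)
    (h : ∀ f g : K → ℂ, IsFourierTransform χ μ f g →
      ∫⁻ ξ, ‖g ξ‖ₑ ^ 2 ∂μ = ∫⁻ ξ in U, ‖g ξ‖ₑ ^ 2 ∂μ) : μ Uᶜ = 0 := by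
  have hball : ∀ T : ℕ, μ ({ξ : K | ‖ξ‖ ≤ (residueCard K : ℝ) ^ (T : ℤ)} \ U) = 0 := by
    intro T
    set B := {ξ : K | ‖ξ‖ ≤ (residueCard K : ℝ) ^ (T : ℤ)} with hB
    have hBm : MeasurableSet B := measurableSet_norm_le _
    obtain ⟨f, hf⟩ := exists_isFourierTransform_indicator (μ := μ) H hχ (T : ℤ)
    have h1 := h f _ hf
    set c : ℂ := (((residueCard K : ℝ) ^ (-(T : ℤ)) : ℝ) : ℂ) with hc
    have hc0 : ‖c‖ₑ ^ 2 ≠ 0 := by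
      have : c ≠ 0 := by
        rw [hc, Complex.ofReal_ne_zero]; exact (zpow_pos H.q_pos _).ne'
      simp [this]
    have hcfin : ‖c‖ₑ ^ 2 ≠ ∞ := ENNReal.pow_ne_top enorm_ne_top
    have h2 : ∀ ν : Measure K, ∫⁻ ξ, ‖B.indicator (fun _ => c) ξ‖ₑ ^ 2 ∂ν = ‖c‖ₑ ^ 2 * ν B := by
      intro ν
      rw [← lintegral_indicator_const hBm]
      congr 1; ext ξ
      by_cases hξ : ξ ∈ B <;> simp [hξ]
    rw [h2, h2, Measure.restrict_apply hBm] at h1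
    have h3 : μ B = μ (B ∩ U) := (ENNReal.mul_right_inj hc0 hcfin).1 h1
    have h4 := measure_inter_add_sdiff₀ (μ := μ) B hU
    rw [← h3] at h4
    exact (ENNReal.add_right_inj (H.measure_norm_le_lt_top _).ne).1 (h4.trans (add_zero _).symm)
  refine measure_mono_null (fun ξ hξ => ?_) (measure_iUnion_null hball)
  obtain ⟨n, hn⟩ := pow_unbounded_of_one_lt ‖ξ‖
    (show (1 : ℝ) < residueCard K by exact_mod_cast H.one_lt_q)
  exact Set.mem_iUnion.2 ⟨n, by simpa using hn.le, hξ⟩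

end Bessel

end LocalFieldWavelet

theorem mainTheorem2 {K : Type*} [NontriviallyNormedField K] [IsUltrametricDist K]
    [LocallyCompactSpace K] [MeasurableSpace K] [BorelSpace K]
    (p : ℕ) [Fact p.Prime] [CharP K p]
    (ϖ : K) (hϖ : IsPrimeElement ϖ) (hnorm : ‖ϖ‖ = (residueCard K : ℝ)⁻¹)
    (μ : Measure K) [μ.IsAddHaarMeasure] (hμ : μ {x : K | ‖x‖ ≤ 1} = 1)
    (χ : AddChar K Circle) (hχ : IsBasicCharacter ϖ χ)
    {c : ℕ} (ε : Fin c → ringOfIntegers K) (hε : IsResidueBasis p ε)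
    (u : ℕ → K) (hu : u = translation p (fun k => (ε k : K)) ϖ)
    {L : ℕ} (ψ : Fin L → K → ℂ) (hψ : ∀ m, MemLp (ψ m) 2 μ)
    (W : Fin L → Set K) (hW : NullMeasurableSet (⋃ m, W m) μ)
    (hψW : ∀ m, fourierL2 χ μ (ψ m) =ᵐ[μ] (W m).indicator (fun _ => (1 : ℂ)))
    (hB : IsBesselet μ ϖ u ψ 1) :
    List.TFAE
      [∀ f : K → ℂ, MemLp f 2 μ →
          eLpNorm f 2 μ ^ 2 =
            ∑' (m : Fin L) (j : ℤ) (t : ℕ), (residueCard K : ℝ≥0∞) ^ (-j) *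
              ‖∫ ξ in ϖ ^ (-j) • W m,
                  fourierL2 χ μ f ξ * (χ (u t * (ϖ ^ j * ξ)) : ℂ) ∂μ‖ₑ ^ 2,
        IsPartitionAE μ (fun i : ℤ × Fin L => ϖ ^ i.1 • W i.2),
        ∫⁻ ξ in ⋃ m, W m, ‖ξ‖ₑ⁻¹ ∂μ = ENNReal.ofReal (((residueCard K : ℝ) - 1) / residueCard K)] := by
  have H : IsNormalized ϖ μ := ⟨hϖ, hnorm, hμ⟩
  have hFT : ∀ m, IsFourierTransform χ μ (ψ m) ((W m).indicator fun _ => 1) := fun m =>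
    (isFourierTransform_fourierL2 H hχ (hψ m)).congr .rfl (hψW m)
  have hWm : ∀ m, NullMeasurableSet (W m) μ := fun m =>
    (aemeasurable_indicator_const_iff (1 : ℂ)).1 (hFT m).2.1.1.aemeasurable
  have hP : ∀ m, ∀ h : K → ℂ, MemLp h 2 μ →
      ∑' t, ‖∫ x in W m, h x * (χ (u t * x) : ℂ) ∂μ‖ₑ ^ 2 = ∫⁻ x in W m, ‖h x‖ₑ ^ 2 ∂μ := by
    intro m h hh
    refine tsum_enorm_sq_setIntegral_eq H hχ.1 (fun T z => ?_) (fun T z hz => ?_) (hWm m)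
      ((hFT m).measure_ne_top (hWm m)) (tsum_enorm_setIntegral_addChar_le H hχ hWm hFT hB m) hh
    · rw [hu]; exact sum_addChar_translation_nonneg hε H.one_lt_q ϖ χ T z
    · rw [hu]; exact sum_addChar_translation_of_norm_le hϖ hnorm hχ ε hz
  have hdisj := pairwise_aedisjoint_dilates H hχ hWm hFT hB hP
  have hUm : NullMeasurableSet (⋃ i : ℤ × Fin L, ϖ ^ i.1 • W i.2) μ :=
    NullMeasurableSet.iUnion fun i => H.nullMeasurableSet_smul _ (hWm _)
  have hL2 : ∀ {f : K → ℂ}, MemLp f 2 μ → IsFourierTransform χ μ f (fourierL2 χ μ f) := fun hf =>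
    isFourierTransform_fourierL2 H hχ hf
  tfae_have 1 ↔ 2 := by
    constructor
    · intro h1
      refine ⟨fun i => H.nullMeasurableSet_smul _ (hWm _), hdisj, ?_⟩
      refine measure_compl_eq_zero_of_forall_lintegral_eq H hχ hUm fun f g hfg => ?_
      have h2 := h1 f hfg.1
      rw [tsum_coefficients_eq H hWm hP hdisj (hL2 hfg.1).2.1, ← hfg.eLpNorm_eq H hχ,
        eLpNorm_two_sq] at h2
      refine h2.trans (lintegral_congr_ae (ae_restrict_of_ae ?_))
      filter_upwards [(hL2 hfg.1).ae_unique H hχ hfg] with ξ hξ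
      rw [hξ]
    · rintro ⟨-, -, hcov⟩ f hf
      have huniv : (⋃ i : ℤ × Fin L, ϖ ^ i.1 • W i.2) =ᵐ[μ] Set.univ := eventuallyEq_univ.2 hcov
      rw [tsum_coefficients_eq H hWm hP hdisj (hL2 hf).2.1, Measure.restrict_congr_set huniv,
        Measure.restrict_univ, ← (hL2 hf).eLpNorm_eq H hχ, eLpNorm_two_sq]
  tfae_have 2 ↔ 3 := by
    rw [H.lintegral_inv_norm_eq hWm hdisj, ← H.measure_norm_eq_one,
      ← H.measure_compl_dilates_eq_zero_iff hWm]
    exact ⟨fun h => h.2.2, fun h => ⟨fun i => H.nullMeasurableSet_smul _ (hWm _), hdisj, h⟩⟩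
  tfae_finish
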